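/- Let $\mathbb{D}=\{z\in\mathbb{C}:|z|<1\}$ and $\mathbb{D}(0,r)=\{z:|z|<r\}$. Let $\Omega\subsetneq\mathbb{C}$ be a domain with $1\in\Omega$ that is starlike with respect to $1$, and let $\phi_\Omega$ be the unique conformal map of $\mathbb{D}$ onto $\Omega$ with $\phi_\Omega(0)=1$ and $\phi_\Omega'(0)>0$. Put $$k_\Omega(z)=\int_0^z\exp\left(\int_0^t\frac{\phi_\Omega(\zeta)-1}{\zeta}\,d\zeta\right)dt,\qquad z\in\mathbb{D},$$ and let $\mathcal{C}(\Omega)$ be the class of analytic functions $f$ on $\mathbb{D}$ with $f(0)=0$, $f'(0)=1$ and $1+zf''(z)/f'(z)\in\Omega$ for all $z\in\mathbb{D}$ (in particular $f'\neq0$ on $\mathbb{D}$). For such $f$, and for $k_\Omega$, let $\log f'$ and $\log k_\Omega'$ denote the analytic branches on $\mathbb{D}$ that vanish at $0$; these exist. For analytic $g,F$ on $\mathbb{D}$, write $g\prec F$ if there is an analytic $\omega$ on $\mathbb{D}$ with $|\omega(z)|\le|z|$ and $g(z)=F(\omega(z))$ for all $z\in\mathbb{D}$. Then $\log k_\Omega'$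 is convex univalent on $\mathbb{D}$ (that is, injective with convex image). For every $f\in\mathcal{C}(\Omega)$ we have $\log f'\prec\log k_\Omega'$, and for every subharmonic function $u:\log k_\Omega'(\mathbb{D})\to[-\infty,\infty)$ (upper semicontinuous, satisfying the sub-mean value inequality on closed disks, and not identically $-\infty$) and every $r\in(0,1)$, $$\int_{-\pi}^{\pi}u(\log f'(re^{i\theta}))\,d\theta\le\int_{-\pi}^{\pi}u(\log k_\Omega'(re^{i\theta}))\,d\theta ,$$ where the integrals are taken in $[-\infty,\infty)$. For given $f$, $u$ and $r$, equality holds if and only if $u$ is harmonic in $\log k_\Omega'(\mathbb{D}(0,r))$ or there is $\varepsilon\in\mathbb{C}$ with $|\varepsilon|=1$ such that $f(z)=\overline{\varepsilon}\,k_\Omega(\varepsilon z)$ for all $z\in\mathbb{D}$. -/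

import Mathlib

open Set MeasureTheory

noncomputable section

namespace MaMinda

/-- The open unit disk `𝔻`. -/
def unitDisk : Set ℂ := Metric.ball 0 1

/-- `φ` maps the unit disk conformally onto `Ω`, with `φ 0 = 1` and `φ' 0 > 0`.
There is at most one such map on the disk. -/
structure IsNormalizedConformalMap (φ : ℂ → ℂ) (Ω : Set ℂ) : Prop where
  analytic : DifferentiableOn ℂ φ unitDisk
  injOn : InjOn φ unitDisk
  image_eq : φ '' unitDisk = Ω
  map_zero : φ 0 = 1
  deriv_zero_im : (deriv φ 0).im = 0
  deriv_zero_re : 0 < (deriv φ 0).re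

/-- The integral `∫₀ᶻ g(ζ) dζ` along the line segment from `0` to `z`. -/
def segmentIntegral (g : ℂ → ℂ) (z : ℂ) : ℂ :=
  ∫ s in (0 : ℝ)..1, z * g ((s : ℂ) * z)

/-- The function `k(z) = ∫₀ᶻ exp (∫₀ᵗ (φ(ζ) - 1) / ζ dζ) dt`. -/
def kFun (φ : ℂ → ℂ) : ℂ → ℂ :=
  segmentIntegral fun t => Complex.exp (segmentIntegral (fun ζ => (φ ζ - 1) / ζ) t)

/-- The class `𝓒(Ω)`: analytic functions on the unit disk with `f 0 = 0`, `f' 0 = 1` such that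
`1 + z f''(z) / f'(z)` is (defined and) in `Ω` for every `z` in the disk. -/
def classC (Ω : Set ℂ) : Set (ℂ → ℂ) :=
  {f | DifferentiableOn ℂ f unitDisk ∧ f 0 = 0 ∧ deriv f 0 = 1 ∧
    ∀ z ∈ unitDisk, deriv f z ≠ 0 ∧ 1 + z * deriv (deriv f) z / deriv f z ∈ Ω}

/-- `g` is the single-valued analytic branch of `log f'` on the unit disk with `g 0 = 0`.
There is at most one such function on the disk. -/
structure IsLogDerivBranch (f g : ℂ → ℂ) : Prop where
  analytic : DifferentiableOn ℂ g unitDisk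
  map_zero : g 0 = 0
  exp_eq : ∀ z ∈ unitDisk, Complex.exp (g z) = deriv f z

/-- `F` is convex univalent on the unit disk: analytic, injective, with convex image. -/
def IsConvexUnivalent (F : ℂ → ℂ) : Prop :=
  DifferentiableOn ℂ F unitDisk ∧ InjOn F unitDisk ∧ Convex ℝ (F '' unitDisk)

/-- Subordination `f ≺ F` on the unit disk. -/
def Subordinate (f F : ℂ → ℂ) : Prop :=
  DifferentiableOn ℂ f unitDisk ∧ DifferentiableOn ℂ F unitDisk ∧
    ∃ ω : ℂ → ℂ, DifferentiableOn ℂ ω unitDisk ∧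
      ∀ z ∈ unitDisk, ‖ω z‖ ≤ ‖z‖ ∧ f z = F (ω z)

/-- The integral `∫_{-π}^{π} g(θ) dθ` of an extended-real-valued function, as the integral of its
positive part minus that of its negative part. It is only used for functions that are bounded above,
so that the first term is finite; the value may be `-∞`. -/
def angleIntegral (g : ℝ → EReal) : EReal :=
  ((∫⁻ θ in Ioc (-Real.pi) Real.pi, (g θ).toENNReal : ENNReal) : EReal) -
    ((∫⁻ θ in Ioc (-Real.pi) Real.pi, (-g θ).toENNReal : ENNReal) : EReal)

/-- The point `c + ρ e^{iθ}`. -/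
def circlePt (c : ℂ) (ρ θ : ℝ) : ℂ := c + (ρ : ℂ) * Complex.exp ((θ : ℂ) * Complex.I)

/-- `u` is subharmonic in the domain `D`: it takes values in `[-∞, ∞)`, is not identically `-∞`,
is upper semicontinuous, and satisfies the sub-mean value inequality
`2π u(c) ≤ ∫_{-π}^{π} u(c + ρ e^{iθ}) dθ` on every closed disk contained in `D`. -/
structure IsSubharmonicOn (u : ℂ → EReal) (D : Set ℂ) : Prop where
  lt_top : ∀ w ∈ D, u w < ⊤
  exists_ne_bot : ∃ w ∈ D, u w ≠ ⊥
  usc : UpperSemicontinuousOn u D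
  submean : ∀ (c : ℂ) (ρ : ℝ), 0 < ρ → Metric.closedBall c ρ ⊆ D →
    ((2 * Real.pi : ℝ) : EReal) * u c ≤ angleIntegral fun θ => u (circlePt c ρ θ)

/-- The extended-real-valued function `u` is (finite and) harmonic in the open set `S`. -/
def IsHarmonicOn (u : ℂ → EReal) (S : Set ℂ) : Prop :=
  ∃ h : ℂ → ℝ, InnerProductSpace.HarmonicOnNhd h S ∧ ∀ w ∈ S, u w = (h w : EReal)

end MaMinda

end

namespace MaMinda

open Filter Topology

/-! Put h = φ - 1, a univalent function whose image is starlike about 0. Then K = log k' satisfies z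
K'(z) = h(z), so K is the Alexander transform of a starlike function and therefore convex univalent
(`re_conj_mul_sub_neg`: each boundary point of the image of a disk has a strict supporting line).
For f in the class, g = log f' satisfies z g'(z) = z f''(z)/f'(z) ∈ h(𝔻). An argument in the manner
of Jack's lemma (`norm_invFunOn_le`, `mapsTo_image`) turns this into g = K ∘ ω with a Schwarz
function ω. Since U = u ∘ K is subharmonic in 𝔻 (`comp_injOn`), the inequality is Littlewood's
subordination inequality for U and ω (`angleIntegral_comp_le`).

The potential theory rests on one device: on a circle, an upper semicontinuous function lies below
the real part of an entire function of nearly the same mean (`exists_entire_majorant`). With a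
maximum principle relative to such real parts (`le_re_of_frontier_le`), questions about subharmonic
functions become statements about means of holomorphic functions, which the value at the centre
determines.

For equality there are two cases. If |ω(z)| = |z| at some z ≠ 0, then ω is a rotation, the means
agree, and f is a rotation of k. Otherwise ω maps the closed disk of radius r into the open one. The
Poisson majorant re F of U has the same mean as U over |z| = r, so equality forces U = re F at a
point inside, hence throughout the open disk. Conversely, let U = re F in the open disk. The mean of
U ∘ ω is 2π U(0), and the mean of U over |z| = r must be shown to be the same. This is not
automatic, because semicontinuity alone would let U jump upwards on the circle;
`angleIntegral_le_of_eq_re` excludes it. -/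

/-! ### Extended-real integrals over the angle. -/

theorem toENNReal_add_sub_identity {x : EReal} {q : ℝ} (h : x ≤ q) :
    x.toENNReal + ((q : EReal) - x).toENNReal + ENNReal.ofReal (-q) =
      ENNReal.ofReal q + (-x).toENNReal := by
  induction x with
  | bot => simp
  | top => simp at h
  | coe x =>
    have h' : x ≤ q := by exact_mod_cast h
    rw [← EReal.coe_sub, ← EReal.coe_neg]
    simp only [EReal.real_coe_toENNReal]
    rcases le_total 0 x with hx | hx
    · rw [ENNReal.ofReal_eq_zero.2 (by linarith : -q ≤ 0),
        ENNReal.ofReal_eq_zero.2 (by linarith : -x ≤ 0), add_zero, add_zero,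
        ← ENNReal.ofReal_add hx (by linarith)]
      congr 1; ring
    · rw [ENNReal.ofReal_eq_zero.2 hx, zero_add]
      rcases le_total 0 q with hq | hq
      · rw [ENNReal.ofReal_eq_zero.2 (by linarith : -q ≤ 0), add_zero,
          ← ENNReal.ofReal_add hq (by linarith)]
        congr 1
      · rw [ENNReal.ofReal_eq_zero.2 hq, zero_add, ← ENNReal.ofReal_add (by linarith) (by linarith)]
        congr 1; ring

/-- Lebesgue measure on the interval `(-π, π]` of angles. -/
noncomputable abbrev angleMeasure : Measure ℝ := volume.restrict (Ioc (-Real.pi) Real.pi)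

theorem EReal_sub_eq_of_add_eq {a b x n p : ENNReal} (hn : n ≠ ⊤) (hp : p ≠ ⊤)
    (ha : a ≠ ⊤) (h : a + x + n = p + b) :
    (a : EReal) - b = ((p.toReal - n.toReal : ℝ) : EReal) - (x : EReal) := by
  lift a to NNReal using ha
  lift n to NNReal using hn
  lift p to NNReal using hp
  by_cases hx : x = ⊤
  · subst hx
    have hb : b = ⊤ := by
      by_contra hb
      rw [add_top, top_add] at h
      exact (ENNReal.add_ne_top.2 ⟨ENNReal.coe_ne_top, hb⟩) h.symm
    subst hb
    simp only [EReal.coe_ennreal_top, EReal.sub_top]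
  · have hb : b ≠ ⊤ := by
      rintro rfl
      rw [add_top] at h
      exact (ENNReal.add_ne_top.2 ⟨ENNReal.add_ne_top.2 ⟨ENNReal.coe_ne_top, hx⟩,
        ENNReal.coe_ne_top⟩) h
    lift x to NNReal using hx
    lift b to NNReal using hb
    have h' : (a : ℝ) + x + n = p + b := by exact_mod_cast h
    simp only [ENNReal.coe_toReal]
    have : ∀ y : NNReal, (((y : ENNReal)) : EReal) = ((y : ℝ) : EReal) := fun y => rfl
    rw [this, this, this, ← EReal.coe_sub, ← EReal.coe_sub]
    congr 1
    linarith

/-- An integrable majorant `q` leaves only the nonnegative gap `q - g` to be integrated, so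
comparisons become statements about one lower integral, and the value -∞ means that this integral is
infinite. -/
theorem angleIntegral_eq_sub {g : ℝ → EReal} {q : ℝ → ℝ} (hg : AEMeasurable g angleMeasure)
    (hq : Integrable q angleMeasure) (h : ∀ᵐ θ ∂angleMeasure, g θ ≤ q θ) :
    angleIntegral g = ((∫ θ, q θ ∂angleMeasure : ℝ) : EReal) -
      ((∫⁻ θ, ((q θ : EReal) - g θ).toENNReal ∂angleMeasure : ENNReal) : EReal) := by
  have hq1 : ∫⁻ θ, ENNReal.ofReal (q θ) ∂angleMeasure ≠ ⊤ := by
    have := hq.2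
    exact ne_top_of_le_ne_top this.ne (lintegral_mono fun θ => by
      rw [← ofReal_norm]; exact ENNReal.ofReal_le_ofReal (le_abs_self _))
  have hq2 : ∫⁻ θ, ENNReal.ofReal (-q θ) ∂angleMeasure ≠ ⊤ := by
    have := hq.2
    exact ne_top_of_le_ne_top this.ne (lintegral_mono fun θ => by
      rw [← ofReal_norm]; exact ENNReal.ofReal_le_ofReal (neg_le_abs _))
  have hI := integral_eq_lintegral_pos_part_sub_lintegral_neg_part hq
  rw [hI]
  refine EReal_sub_eq_of_add_eq hq2 hq1 ?_ ?_
  · refine ne_top_of_le_ne_top hq1 (lintegral_mono_ae ?_)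
    filter_upwards [h] with θ hθ
    simpa using EReal.toENNReal_le_toENNReal hθ
  · have hneg : AEMeasurable (fun θ => ENNReal.ofReal (-q θ)) angleMeasure :=
      hq.neg.aestronglyMeasurable.aemeasurable.ennreal_ofReal
    rw [← lintegral_add_left' hg.ereal_toENNReal,
      ← lintegral_add_right' _ hneg,
      ← lintegral_add_left' hq.aestronglyMeasurable.aemeasurable.ennreal_ofReal]
    refine lintegral_congr_ae ?_
    filter_upwards [h] with θ hθ
    exact toENNReal_add_sub_identity hθ

theorem angleIntegral_coe {q : ℝ → ℝ} (hq : Integrable q angleMeasure) :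
    angleIntegral (fun θ => (q θ : EReal)) = ((∫ θ, q θ ∂angleMeasure : ℝ) : EReal) := by
  rw [angleIntegral_eq_sub (q := q) (g := fun θ => (q θ : EReal))
    (measurable_coe_real_ereal.comp_aemeasurable hq.aestronglyMeasurable.aemeasurable) hq
    (ae_of_all _ fun _ => le_rfl)]
  simp

theorem angleIntegral_le {g : ℝ → EReal} {q : ℝ → ℝ} (hg : AEMeasurable g angleMeasure)
    (hq : Integrable q angleMeasure) (h : ∀ᵐ θ ∂angleMeasure, g θ ≤ q θ) :
    angleIntegral g ≤ ((∫ θ, q θ ∂angleMeasure : ℝ) : EReal) := by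
  rw [angleIntegral_eq_sub hg hq h]
  exact EReal.sub_le_of_le_add (le_add_of_nonneg_right (EReal.coe_ennreal_nonneg _))

/-- The gap `q - g` is nonnegative with integral zero. -/
theorem angleIntegral_eq_of_le {g : ℝ → EReal} {q : ℝ → ℝ} (hg : AEMeasurable g angleMeasure)
    (hq : Integrable q angleMeasure) (h : ∀ᵐ θ ∂angleMeasure, g θ ≤ q θ)
    (hle : ((∫ θ, q θ ∂angleMeasure : ℝ) : EReal) ≤ angleIntegral g) :
    ∀ᵐ θ ∂angleMeasure, g θ = q θ := by
  rw [angleIntegral_eq_sub hg hq h] at hle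
  have h0 : ∫⁻ θ, ((q θ : EReal) - g θ).toENNReal ∂angleMeasure = 0 := by
    generalize (∫⁻ θ, ((q θ : EReal) - g θ).toENNReal ∂angleMeasure) = x at hle
    by_cases hx : x = ⊤
    · subst hx
      simp at hle
    · lift x to NNReal using hx
      have : (((x : ENNReal)) : EReal) = ((x : ℝ) : EReal) := rfl
      rw [this, ← EReal.coe_sub, EReal.coe_le_coe_iff] at hle
      have : (x : ℝ) = 0 := le_antisymm (by linarith) x.2
      exact_mod_cast this
  have hm : AEMeasurable (fun θ => ((q θ : EReal) - g θ).toENNReal) angleMeasure := by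
    simp only [sub_eq_add_neg]
    exact ((measurable_coe_real_ereal.comp_aemeasurable
      hq.aestronglyMeasurable.aemeasurable).add hg.neg).ereal_toENNReal
  rw [lintegral_eq_zero_iff' hm] at h0
  filter_upwards [h, h0] with θ h1 h2
  simp only [Pi.zero_apply, EReal.toENNReal_eq_zero_iff] at h2
  refine le_antisymm h1 ?_
  rwa [EReal.sub_nonpos] at h2

/-! ### Majorants of semicontinuous functions by real parts of entire functions. -/

/-- Infimal convolution: the infimum over y of `min (W y) n + n * edist x y` is Lipschitz in x with
constant n. Truncation at n keeps it finite. Near x semicontinuity bounds `W` below; far from x the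
distance term is large. -/
theorem exists_continuous_iSup_eq {X : Type*} [PseudoEMetricSpace X] {W : X → ENNReal}
    (hW : LowerSemicontinuous W) :
    ∃ f : ℕ → X → NNReal, (∀ n, Continuous (f n)) ∧ (∀ x, Monotone fun n => f n x) ∧
      ∀ x, ⨆ n, (f n x : ENNReal) = W x := by
  set F : ℕ → X → ENNReal := fun n x => ⨅ y, (min (W y) n + n * edist x y) with hF
  have hle : ∀ n x, F n x ≤ min (W x) n := fun n x =>
    (iInf_le _ x).trans (by simp)
  have hfin : ∀ n x, F n x ≠ ⊤ := fun n x =>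
    ne_top_of_le_ne_top (ENNReal.natCast_ne_top n) ((hle n x).trans (min_le_right _ _))
  have hcont : ∀ n, Continuous (F n) := by
    intro n
    refine continuous_of_le_add_edist n (ENNReal.natCast_ne_top n) fun x y => ?_
    rw [hF, ENNReal.iInf_add]
    refine le_iInf fun z => (iInf_le _ z).trans ?_
    rw [add_assoc, ← mul_add]
    gcongr
    rw [add_comm]
    exact edist_triangle _ _ _
  have hmono : ∀ x, Monotone fun n => F n x := by
    intro x m n hmn
    have : (m : ENNReal) ≤ n := by exact_mod_cast hmn
    refine iInf_mono fun y => ?_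
    gcongr
  have hcoe : ∀ n x, (((F n x).toNNReal : NNReal) : ENNReal) = F n x := fun n x =>
    ENNReal.coe_toNNReal (hfin n x)
  refine ⟨fun n x => (F n x).toNNReal, fun n => ?_, fun x m n hmn => ?_, fun x => ?_⟩
  · exact ENNReal.continuousOn_toNNReal.comp_continuous (hcont n) fun x => hfin n x
  · exact ENNReal.toNNReal_mono (hfin n x) (hmono x hmn)
  · simp only [hcoe]
    refine le_antisymm (iSup_le fun n => (hle n x).trans (min_le_left _ _)) ?_
    refine le_of_forall_lt fun c hc => ?_
    obtain ⟨d, hcd, hdW⟩ := exists_between hc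
    have hd : d ≠ ⊤ := (hdW.trans_le le_top).ne
    obtain ⟨δ, hδ, hball⟩ := EMetric.mem_nhds_iff.1 (hW x d hdW)
    obtain ⟨N, hN⟩ : ∃ N : ℕ, d ≤ N ∧ d ≤ N * δ := by
      have hdδ : d / δ ≠ ⊤ := ENNReal.div_ne_top hd hδ.ne'
      obtain ⟨N, hN⟩ := ENNReal.exists_nat_gt (ENNReal.add_ne_top.2 ⟨hd, hdδ⟩)
      refine ⟨N, (le_self_add.trans hN.le), ?_⟩
      by_cases hδt : δ = ⊤
      · subst hδt
        have : (N : ENNReal) ≠ 0 := by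
          intro h; rw [h] at hN; simp at hN
        rw [ENNReal.mul_top this]; exact le_top
      · exact (ENNReal.div_le_iff hδ.ne' hδt).1 (le_add_self.trans hN.le)
    refine hcd.trans_le (le_trans ?_ (le_iSup _ N))
    refine le_iInf fun y => ?_
    by_cases hy : edist x y < δ
    · have := hball (show y ∈ _ by rw [Metric.mem_eball, edist_comm]; exact hy)
      exact (le_min (le_of_lt this) hN.1).trans le_self_add
    · exact (hN.2.trans (by gcongr; exact not_lt.1 hy)).trans le_add_self

/-- Real parts of polynomials approximate continuous functions on the circle. -/
theorem exists_entire_approx {q : AddCircle (2 * Real.pi) → ℝ} (hq : Continuous q) {ε : ℝ}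
    (hε : 0 < ε) :
    ∃ P : ℂ → ℂ, Differentiable ℂ P ∧ 
      ∀ θ : ℝ, |(P (Complex.exp (θ * Complex.I))).re - q θ| < ε := by
  have : Fact (0 < 2 * Real.pi) := ⟨by positivity⟩
  let f : C(AddCircle (2 * Real.pi), ℂ) := ⟨fun x => (q x : ℂ), by fun_prop⟩
  have hf : f ∈ (Submodule.span ℂ (range <| @fourier (2 * Real.pi))).topologicalClosure := by
    rw [span_fourier_closure_eq_top]; trivial
  have hf' : f ∈ closure ((Submodule.span ℂ (range <| @fourier (2 * Real.pi)) :
    Submodule ℂ C(AddCircle (2 * Real.pi), ℂ)) : Set C(AddCircle (2 * Real.pi), ℂ)) := hf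
  obtain ⟨p, hp, hpf⟩ := Metric.mem_closure_iff.1 hf' ε hε
  -- The factor `c` is quantified so that the span induction passes through complex scalar
  -- multiples.
  have key : ∀ c : ℂ, ∃ P : ℂ → ℂ, Differentiable ℂ P ∧
      ∀ θ : ℝ, (P (Complex.exp (θ * Complex.I))).re = (c * p θ).re := by
    clear hpf hf hf' f
    change p ∈ Submodule.span ℂ (range <| @fourier (2 * Real.pi)) at hp
    induction hp using Submodule.span_induction with
    | mem x hx =>
      obtain ⟨n, rfl⟩ := hx
      intro c
      have hexp : ∀ θ : ℝ, fourier n (θ : AddCircle (2 * Real.pi)) =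
          Complex.exp (θ * Complex.I) ^ n := by
        intro θ
        rw [fourier_coe_apply, ← Complex.exp_int_mul]
        congr 1
        have : (Real.pi : ℂ) ≠ 0 := by exact_mod_cast Real.pi_ne_zero
        push_cast
        field_simp
      rcases Int.eq_nat_or_neg n with ⟨m, rfl | rfl⟩
      · exact ⟨fun z => c * z ^ m, by fun_prop, fun θ => by rw [hexp]; simp⟩
      -- A negative frequency is the conjugate of a positive one on the circle, and conjugation does
      -- not change the real part.
      · refine ⟨fun z => (starRingEnd ℂ) c * z ^ m, by fun_prop, fun θ => ?_⟩
        rw [hexp, ← Complex.conj_re]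
        congr 1
        rw [map_mul, Complex.conj_conj, map_pow, ← Complex.exp_conj]
        congr 1
        rw [zpow_neg, zpow_natCast, ← inv_pow, ← Complex.exp_neg]
        simp
    | zero => exact fun c => ⟨0, differentiable_const _, by simp⟩
    | add x y _ _ hx hy =>
      intro c
      obtain ⟨P, hP, hP'⟩ := hx c
      obtain ⟨Q, hQ, hQ'⟩ := hy c
      exact ⟨P + Q, hP.add hQ, fun θ => by simp [hP', hQ', mul_add, -Complex.mul_re]⟩
    | smul a x _ hx =>
      intro c
      obtain ⟨P, hP, hP'⟩ := hx (c * a)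
      exact ⟨P, hP, fun θ => by rw [hP']; simp [mul_assoc, -Complex.mul_re]⟩
  obtain ⟨P, hP, hP'⟩ := key 1
  refine ⟨P, hP, fun θ => ?_⟩
  rw [hP', one_mul]
  have h1 : dist (f θ) (p θ) < ε := (ContinuousMap.dist_apply_le_dist _).trans_lt hpf
  rw [dist_comm, dist_eq_norm] at h1
  have h2 := (Complex.abs_re_le_norm (p θ - f θ)).trans_lt h1
  simpa [f] using h2

theorem circlePt_eq_circleMap : circlePt = circleMap := rfl

theorem circlePt_mem_sphere (c : ℂ) {ρ : ℝ} (hρ : 0 ≤ ρ) (θ : ℝ) :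
    circlePt c ρ θ ∈ Metric.sphere c ρ := circleMap_mem_sphere c hρ θ

theorem exists_circlePt_eq {c z : ℂ} {ρ : ℝ} (hρ : 0 ≤ ρ) (hz : z ∈ Metric.sphere c ρ) :
    ∃ θ, circlePt c ρ θ = z := by
  have := range_circleMap c ρ
  rw [abs_of_nonneg hρ] at this
  rw [← this] at hz
  exact hz

theorem continuous_circlePt (c : ℂ) (ρ : ℝ) : Continuous (circlePt c ρ) :=
  continuous_circleMap c ρ

theorem integral_angleMeasure_eq_circleAverage (f : ℂ → ℝ) (c : ℂ) (ρ : ℝ) :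
    ∫ θ, f (circlePt c ρ θ) ∂angleMeasure = 2 * Real.pi * Real.circleAverage f c ρ := by
  have hper : (fun θ => f (circlePt c ρ θ)).Periodic (2 * Real.pi) := fun x => by
    simp [circlePt_eq_circleMap, periodic_circleMap c ρ x]
  have := hper.intervalIntegral_add_eq 0 (-Real.pi)
  rw [zero_add, show -Real.pi + 2 * Real.pi = Real.pi by ring,
    intervalIntegral.integral_of_le (by positivity)] at this
  rw [Real.circleAverage_def, smul_eq_mul, ← mul_assoc, mul_inv_cancel₀ (by positivity), one_mul,
    intervalIntegral.integral_of_le (by positivity)]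
  exact (this.trans (intervalIntegral.integral_of_le (by linarith [Real.pi_pos]))).symm

theorem integrable_angleMeasure_of_continuous {q : ℝ → ℝ} (hq : Continuous q) :
    Integrable q angleMeasure :=
  (hq.integrableOn_Icc (a := -Real.pi) (b := Real.pi)).mono_set Ioc_subset_Icc_self

theorem integral_re_circlePt {F : ℂ → ℂ} {c : ℂ} {ρ : ℝ} (hρ : 0 < ρ)
    (hF : DiffContOnCl ℂ F (Metric.ball c ρ)) :
    ∫ θ, (F (circlePt c ρ θ)).re ∂angleMeasure = 2 * Real.pi * (F c).re := by
  have h1 := integral_angleMeasure_eq_circleAverage (fun z => (F z).re) c ρ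
  rw [h1]
  congr 1
  have h2 : Real.circleAverage F c ρ = F c := by
    rw [← abs_of_pos hρ] at hF
    exact hF.circleAverage
  have h3 := Complex.reCLM.circleAverage_comp_comm (f := F) (c := c) (R := ρ) (by
    refine ContinuousOn.circleIntegrable hρ.le ?_
    have := hF.continuousOn
    rw [closure_ball _ hρ.ne'] at this
    exact this.mono Metric.sphere_subset_closedBall)
  rw [h2] at h3
  exact h3

theorem integral_angleMeasure_const (a : ℝ) : ∫ _, a ∂angleMeasure = 2 * Real.pi * a := by
  simp [Real.pi_pos.le, two_mul]

theorem upperSemicontinuous_comp_circlePt {u : ℂ → EReal} {c : ℂ} {ρ : ℝ} (hρ : 0 ≤ ρ)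
    (hu : UpperSemicontinuousOn u (Metric.sphere c ρ)) :
    UpperSemicontinuous fun θ => u (circlePt c ρ θ) := by
  rw [← upperSemicontinuousOn_univ_iff]
  exact hu.comp (continuous_circlePt c ρ).continuousOn fun θ _ => circlePt_mem_sphere c hρ θ

theorem continuous_coe_sub_toENNReal (C : ℝ) :
    Continuous fun x : EReal => ((C : EReal) - x).toENNReal := by
  refine EReal.continuous_toENNReal.comp ?_
  rw [continuous_iff_continuousAt]
  intro x
  exact ContinuousAt.comp (f := fun x : EReal => ((C : EReal), -x))
    (g := fun p : EReal × EReal => p.1 + p.2) (EReal.continuousAt_add (by simp) (by simp))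
    (continuous_const.prodMk continuous_neg).continuousAt

/-- An upper semicontinuous function on a circle is approximated from above by real parts of
entire functions. -/
theorem exists_entire_majorant {u : ℂ → EReal} {c : ℂ} {ρ C a : ℝ} (hρ : 0 < ρ)
    (hu : UpperSemicontinuousOn u (Metric.sphere c ρ)) (hC : ∀ z ∈ Metric.sphere c ρ, u z ≤ C)
    (ha : angleIntegral (fun θ => u (circlePt c ρ θ)) < a) :
    ∃ H : ℂ → ℂ, Differentiable ℂ H ∧
      (∀ z ∈ Metric.sphere c ρ, u z < (H z).re ∧ (H z).re < C + 1) ∧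
      2 * Real.pi * (H c).re < a := by
  have : Fact (0 < 2 * Real.pi) := ⟨by positivity⟩
  let e : AddCircle (2 * Real.pi) → ℂ := fun x => c + ρ * (AddCircle.toCircle x : ℂ)
  have he : Continuous e := by
    have := AddCircle.continuous_toCircle (T := 2 * Real.pi)
    fun_prop
  have he' : ∀ θ : ℝ, e θ = circlePt c ρ θ := by
    intro θ
    simp only [e, circlePt, AddCircle.toCircle_apply_mk, Circle.coe_exp]
    congr 4
    rw [div_self (by positivity), one_mul]
  have hes : ∀ x, e x ∈ Metric.sphere c ρ := by
    intro x
    simp [e, abs_of_pos hρ, Circle.norm_coe]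
  let W : AddCircle (2 * Real.pi) → ENNReal := fun x => ((C : EReal) - u (e x)).toENNReal
  have hW : LowerSemicontinuous W := by
    refine (continuous_coe_sub_toENNReal C).comp_upperSemicontinuous_antitone ?_ ?_
    · rw [← upperSemicontinuousOn_univ_iff]
      exact hu.comp he.continuousOn fun θ _ => hes θ
    · exact fun x y hxy => EReal.toENNReal_le_toENNReal (EReal.sub_le_sub le_rfl hxy)
  obtain ⟨f, hf, hmono, hsup⟩ := exists_continuous_iSup_eq hW
  have hmeas : AEMeasurable (fun θ => u (circlePt c ρ θ)) angleMeasure :=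
    (upperSemicontinuous_comp_circlePt hρ.le hu).measurable.aemeasurable
  rw [angleIntegral_eq_sub hmeas (integrable_const C)
    (ae_of_all _ fun θ => hC _ (circlePt_mem_sphere c hρ.le θ)), integral_angleMeasure_const] at ha
  have hlin : ∫⁻ θ, ((C : EReal) - u (circlePt c ρ θ)).toENNReal ∂angleMeasure =
      ⨆ n, ∫⁻ θ : ℝ, (f n (θ : AddCircle (2 * Real.pi)) : ENNReal) ∂angleMeasure := by
    rw [← lintegral_iSup]
    · refine lintegral_congr fun θ => ?_
      rw [hsup]
      simp only [W, he']
    · exact fun n => (ENNReal.continuous_coe.comp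
        ((hf n).comp (AddCircle.continuous_mk' _))).measurable
    · exact fun m n hmn θ => ENNReal.coe_le_coe.2 (hmono θ hmn)
  have hc1 : ∀ n, Continuous fun θ : ℝ => (f n (θ : AddCircle (2 * Real.pi)) : ℝ) := fun n =>
    NNReal.continuous_coe.comp ((hf n).comp (AddCircle.continuous_mk' _))
  -- Monotone convergence: the integrals of `f n` increase to that of `C - u`, so some continuous `C
  -- - f n` above `u` already has mean below `a`.
  obtain ⟨n, hn⟩ : ∃ n, 2 * Real.pi * C - ∫ θ : ℝ, (f n θ : ℝ) ∂angleMeasure < a := by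
    by_contra! hcon
    rw [hlin] at ha
    have hsupn : ⨆ n, ∫⁻ θ : ℝ, (f n (θ : AddCircle (2 * Real.pi)) : ENNReal) ∂angleMeasure ≤
        ENNReal.ofReal (2 * Real.pi * C - a) := by
      refine iSup_le fun n => ?_
      rw [lintegral_coe_eq_integral _ (integrable_angleMeasure_of_continuous (hc1 n))]
      exact ENNReal.ofReal_le_ofReal (by linarith [hcon n])
    have hnn : 0 ≤ ∫ θ : ℝ, (f 0 (θ : AddCircle (2 * Real.pi)) : ℝ) ∂angleMeasure :=
      integral_nonneg fun θ => (f 0 (θ : AddCircle (2 * Real.pi))).2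
    have h0 : 0 ≤ 2 * Real.pi * C - a := by linarith [hcon 0]
    have h1 := EReal.coe_ennreal_le_coe_ennreal_iff.2 hsupn
    rw [EReal.coe_ennreal_ofReal, max_eq_left h0] at h1
    have h2 := EReal.sub_le_sub (le_refl ((2 * Real.pi * C : ℝ) : EReal)) h1
    rw [← EReal.coe_sub, sub_sub_cancel] at h2
    exact absurd ha (not_lt.2 h2)
  set I := ∫ θ : ℝ, (f n θ : ℝ) ∂angleMeasure with hI
  obtain ⟨ε, hε, hε1, hε2⟩ : ∃ ε : ℝ, 0 < ε ∧ ε < 1 / 2 ∧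
      2 * Real.pi * C - I + 2 * Real.pi * (2 * ε) < a := by
    have hpi := Real.pi_pos
    set d := a - (2 * Real.pi * C - I) with hd
    have hd0 : 0 < d := by linarith
    refine ⟨min (1 / 4) (d / (8 * Real.pi)), by positivity, (min_le_left _ _).trans_lt (by norm_num),
      ?_⟩
    have h1 : min (1 / 4) (d / (8 * Real.pi)) ≤ d / (8 * Real.pi) := min_le_right _ _
    rw [le_div_iff₀ (by positivity)] at h1
    nlinarith
  -- Approximating `C - f n + ε` within `ε` keeps the real part strictly above `C - f n` and below
  -- `C - f n + 2ε`; the latter is less than `C + 1` because `ε < 1/2`.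
  obtain ⟨P, hP, hPa⟩ := exists_entire_approx (q := fun x => C - f n x + ε)
    (by have := hf n; fun_prop) hε
  refine ⟨fun z => P ((z - c) / ρ), by fun_prop, fun z hz => ?_, ?_⟩
  · obtain ⟨θ, rfl⟩ := exists_circlePt_eq hρ.le hz
    have hρ' : (ρ : ℂ) ≠ 0 := by exact_mod_cast hρ.ne'
    have : (circlePt c ρ θ - c) / ρ = Complex.exp (θ * Complex.I) := by
      simp [circlePt, hρ']
    simp only [this]
    have h1 := abs_lt.1 (hPa θ)
    have h2 : (0 : ℝ) ≤ f n θ := (f n θ).2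
    refine ⟨?_, by linarith⟩
    have h3 : (f n (θ : AddCircle (2 * Real.pi)) : ENNReal) ≤
        ((C : EReal) - u (circlePt c ρ θ)).toENNReal := by
      rw [← he']
      change _ ≤ W θ
      rw [← hsup]
      exact le_iSup (fun n => (f n (θ : AddCircle (2 * Real.pi)) : ENNReal)) n
    have h4 : u (circlePt c ρ θ) ≤ ((C - f n θ : ℝ) : EReal) := by
      have h5 := hC _ (circlePt_mem_sphere c hρ.le θ)
      generalize u (circlePt c ρ θ) = x at h3 h5
      induction x with
      | bot => exact bot_le
      | top => simp at h5
      | coe x =>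
        have h5' : x ≤ C := by exact_mod_cast h5
        rw [← EReal.coe_sub, EReal.real_coe_toENNReal, ← ENNReal.ofReal_coe_nnreal,
          ENNReal.ofReal_le_ofReal_iff (by linarith)] at h3
        exact_mod_cast (by linarith : x ≤ C - f n θ)
    refine h4.trans_lt ?_
    exact_mod_cast (by linarith)
  · have h1 := integral_re_circlePt (F := P) (c := 0) (ρ := 1) one_pos hP.diffContOnCl
    simp only [sub_self, zero_div]
    rw [← h1]
    have := hc1 n
    have h2 : ∫ θ, (P (circlePt 0 1 θ)).re ∂angleMeasure ≤
        ∫ θ : ℝ, (C - f n θ + 2 * ε) ∂angleMeasure := by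
      refine integral_mono (integrable_angleMeasure_of_continuous ?_)
        (integrable_angleMeasure_of_continuous (by fun_prop)) fun θ => ?_
      · exact Complex.continuous_re.comp (hP.continuous.comp (continuous_circlePt _ _))
      · have h1 := abs_lt.1 (hPa θ)
        have : circlePt 0 1 θ = Complex.exp (θ * Complex.I) := by simp [circlePt]
        simp only [this]
        linarith
    have h3 : ∫ θ : ℝ, (C - f n θ + 2 * ε) ∂angleMeasure =
        2 * Real.pi * C - I + 2 * Real.pi * (2 * ε) := by
      rw [integral_add, integral_sub, integral_angleMeasure_const, integral_angleMeasure_const]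
      all_goals exact integrable_angleMeasure_of_continuous (by fun_prop)
    linarith

/-! ### Contact and maximum principles relative to real parts of holomorphic functions. -/

theorem exists_circlePt_eq_of_Ioc {c z : ℂ} {ρ : ℝ} (hz : z ∈ Metric.sphere c ρ) :
    ∃ θ ∈ Ioc (-Real.pi) Real.pi, circlePt c ρ θ = z := by
  refine ⟨(z - c).arg, Complex.arg_mem_Ioc _, ?_⟩
  rw [mem_sphere_iff_norm] at hz
  rw [circlePt, ← hz, Complex.norm_mul_exp_arg_mul_I]
  ring

/-- A neighbourhood of any angle, even of the endpoint π, meets (-π, π] in positive measure. This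
lets almost everywhere information contradict a strict inequality that semicontinuity spreads over
an arc. -/
theorem exists_of_ae_angleMeasure {P : ℝ → Prop} (h : ∀ᵐ θ ∂angleMeasure, P θ) {U : Set ℝ}
    (hU : IsOpen U) {θ₀ : ℝ} (h₀ : θ₀ ∈ Ioc (-Real.pi) Real.pi) (hU₀ : θ₀ ∈ U) : ∃ θ ∈ U, P θ := by
  by_contra! hcon
  have h1 : (U ∩ Ioo (-Real.pi) Real.pi).Nonempty := by
    have : θ₀ ∈ closure (Ioo (-Real.pi) Real.pi) := by
      rw [closure_Ioo (by linarith [Real.pi_pos])]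
      exact Ioc_subset_Icc_self h₀
    exact mem_closure_iff.1 this U hU hU₀
  have h2 : 0 < volume (U ∩ Ioo (-Real.pi) Real.pi) := (hU.inter isOpen_Ioo).measure_pos _ h1
  rw [ae_restrict_iff' measurableSet_Ioc] at h
  have h3 : volume (U ∩ Ioo (-Real.pi) Real.pi) = 0 :=
    measure_mono_null (fun θ hθ => fun h => hcon θ hθ.1 (h (Ioo_subset_Ioc_self hθ.2))) h
  exact h2.ne' h3

namespace IsSubharmonicOn
variable {u : ℂ → EReal} {D : Set ℂ}

theorem eventually_lt (hu : IsSubharmonicOn u D) (hD : IsOpen D) {x : ℂ} (hx : x ∈ D) {y : EReal}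
    (hy : u x < y) : ∀ᶠ z in 𝓝 x, u z < y := by
  have := hu.usc x hx y hy
  rwa [hD.nhdsWithin_eq hx] at this

theorem measurable_circlePt (hu : IsSubharmonicOn u D) {c : ℂ} {ρ : ℝ} (hρ : 0 ≤ ρ)
    (hcD : Metric.sphere c ρ ⊆ D) : AEMeasurable (fun θ => u (circlePt c ρ θ)) angleMeasure :=
  (upperSemicontinuous_comp_circlePt hρ (hu.usc.mono hcD)).measurable.aemeasurable

/-- If `u ≤ re F` on a circle, with equality at the centre, then equality holds on the circle. -/
theorem eq_re_on_sphere (hu : IsSubharmonicOn u D) (hD : IsOpen D) {c : ℂ} {ρ : ℝ} (hρ : 0 < ρ)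
    (hcD : Metric.closedBall c ρ ⊆ D) {F : ℂ → ℂ} (hF : DiffContOnCl ℂ F (Metric.ball c ρ))
    (hle : ∀ z ∈ Metric.sphere c ρ, u z ≤ (F z).re) (hc : u c = (F c).re) :
    ∀ z ∈ Metric.sphere c ρ, u z = (F z).re := by
  have hsD := Metric.sphere_subset_closedBall.trans hcD
  have hFs : ContinuousOn F (Metric.sphere c ρ) := by
    have := hF.continuousOn
    rw [closure_ball _ hρ.ne'] at this
    exact this.mono Metric.sphere_subset_closedBall
  have hFc : Continuous fun θ => (F (circlePt c ρ θ)).re :=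
    Complex.continuous_re.comp (hFs.comp_continuous (continuous_circlePt c ρ)
      fun θ => circlePt_mem_sphere c hρ.le θ)
  have hae : ∀ᵐ θ ∂angleMeasure, u (circlePt c ρ θ) = (F (circlePt c ρ θ)).re := by
    refine angleIntegral_eq_of_le (hu.measurable_circlePt hρ.le hsD)
      (integrable_angleMeasure_of_continuous hFc)
      (ae_of_all _ fun θ => hle _ (circlePt_mem_sphere c hρ.le θ)) ?_
    rw [integral_re_circlePt hρ hF, EReal.coe_mul, ← hc]
    exact hu.submean c ρ hρ hcD
  intro z hz
  refine (hle z hz).antisymm (not_lt.1 fun hlt => ?_)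
  obtain ⟨y, hy1, hy2⟩ := EReal.lt_iff_exists_real_btwn.1 hlt
  obtain ⟨θ₀, hθ₀, rfl⟩ := exists_circlePt_eq_of_Ioc hz
  have hev : ∀ᶠ θ in 𝓝 θ₀, u (circlePt c ρ θ) < (F (circlePt c ρ θ)).re := by
    filter_upwards [(continuous_circlePt c ρ).continuousAt.eventually
      (hu.eventually_lt hD (hsD hz) hy1), hFc.continuousAt.eventually_const_lt
        (show y < _ from by exact_mod_cast hy2)] with θ h1 h2
    exact h1.trans (by exact_mod_cast h2)
  obtain ⟨V, hV, hVo, hV₀⟩ := eventually_nhds_iff.1 hev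
  obtain ⟨θ, hθ, hθ'⟩ := exists_of_ae_angleMeasure hae hVo hθ₀ hV₀
  exact (hV θ hθ).ne hθ'

/-- The contact set is open, because contact at a centre spreads to every small circle about it, and
relatively closed, because `u < re F` is an open condition by semicontinuity. -/
theorem eq_re_of_isPreconnected (hu : IsSubharmonicOn u D) (hD : IsOpen D) {S : Set ℂ}
    (hS : IsOpen S) (hSc : IsPreconnected S) (hSD : S ⊆ D) {F : ℂ → ℂ}
    (hF : DifferentiableOn ℂ F S) (hle : ∀ z ∈ S, u z ≤ (F z).re) {x₀ : ℂ} (hx₀ : x₀ ∈ S)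
    (heq : u x₀ = (F x₀).re) : ∀ z ∈ S, u z = (F z).re := by
  let E : Set ℂ := {z | z ∈ S ∧ u z = (F z).re}
  have hE : IsOpen E := by
    rw [Metric.isOpen_iff]
    rintro c ⟨hc, hc'⟩
    obtain ⟨ε, hε, hball⟩ := Metric.isOpen_iff.1 hS c hc
    refine ⟨ε, hε, fun z hz => ⟨hball hz, ?_⟩⟩
    rcases eq_or_ne z c with rfl | hne
    · exact hc'
    have hsub : Metric.closedBall c (dist z c) ⊆ S :=
      (Metric.closedBall_subset_ball hz).trans hball
    refine hu.eq_re_on_sphere hD (dist_pos.2 hne) (hsub.trans hSD) ?_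
      (fun w hw => hle w (hsub (Metric.sphere_subset_closedBall hw))) hc' z rfl
    exact (hF.mono hsub).diffContOnCl_ball subset_rfl
  have hcl : closure E ∩ S ⊆ E := by
    rintro x ⟨hx, hxS⟩
    refine ⟨hxS, (hle x hxS).antisymm (not_lt.1 fun hlt => ?_)⟩
    obtain ⟨y, hy1, hy2⟩ := EReal.lt_iff_exists_real_btwn.1 hlt
    have hFx : ContinuousAt (fun z => (F z).re) x :=
      Complex.continuous_re.continuousAt.comp (hF.continuousOn.continuousAt (hS.mem_nhds hxS))
    have hev : ∀ᶠ z in 𝓝 x, u z < (F z).re := by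
      filter_upwards [hu.eventually_lt hD (hSD hxS) hy1, hFx.eventually_const_lt
        (show y < _ from by exact_mod_cast hy2)] with θ h1 h2
      exact h1.trans (by exact_mod_cast h2)
    obtain ⟨V, hV, hVo, hV₀⟩ := eventually_nhds_iff.1 hev
    obtain ⟨z, hzV, hzE⟩ := mem_closure_iff.1 hx V hVo hV₀
    exact (hV z hzV).ne hzE.2
  have := hSc.subset_of_closure_inter_subset hE ⟨x₀, hx₀, hx₀, heq⟩ hcl
  exact fun z hz => (this hz).2

/-- The maximum principle relative to the real part of a holomorphic function. -/
theorem le_re_of_frontier_le (hu : IsSubharmonicOn u D) (hD : IsOpen D) {G : Set ℂ}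
    (hG : IsOpen G) (hGc : IsCompact (closure G)) (hGD : closure G ⊆ D) {F : ℂ → ℂ}
    (hF : DiffContOnCl ℂ F G) (hle : ∀ z ∈ frontier G, u z ≤ (F z).re) :
    ∀ z ∈ G, u z ≤ (F z).re := by
  by_contra! hcon
  obtain ⟨z₀, hz₀, hlt⟩ := hcon
  let v : ℂ → EReal := fun z => u z + ((-(F z).re : ℝ) : EReal)
  have hv : UpperSemicontinuousOn v (closure G) := by
    refine UpperSemicontinuousOn.add' (hu.usc.mono hGD) ?_ fun z _ =>
      EReal.continuousAt_add (by simp) (by simp)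
    refine ContinuousOn.upperSemicontinuousOn ?_
    exact continuous_coe_real_ereal.comp_continuousOn
      (Complex.continuous_re.comp_continuousOn hF.continuousOn).neg
  obtain ⟨x₀, hx₀, hmax⟩ := hv.exists_isMaxOn ⟨z₀, subset_closure hz₀⟩ hGc
  have hvpos : 0 < v z₀ := by
    have : v z₀ = u z₀ - ((F z₀).re : EReal) := by
      simp [v, sub_eq_add_neg]
    rw [this]
    exact EReal.sub_pos.2 hlt
  have hx₀pos : 0 < v x₀ := hvpos.trans_le (hmax (subset_closure hz₀))
  obtain ⟨m, hm⟩ : ∃ m : ℝ, v x₀ = m := by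
    have h1 : v x₀ ≠ ⊥ := (bot_le.trans_lt hx₀pos).ne'
    have h2 : v x₀ ≠ ⊤ := (EReal.add_lt_top (hu.lt_top _ (hGD hx₀)).ne (by simp)).ne
    exact ⟨(v x₀).toReal, (EReal.coe_toReal h2 h1).symm⟩
  have hm0 : 0 < m := by rw [hm] at hx₀pos; exact_mod_cast hx₀pos
  have hvle : ∀ z, v z ≤ m ↔ u z ≤ (F z + m).re := by
    intro z
    have : (((F z + m).re : ℝ) : EReal) = m - ((-(F z).re : ℝ) : EReal) := by
      rw [← EReal.coe_sub]; simp [add_comm]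
    rw [this, EReal.le_sub_iff_add_le (by simp) (by simp)]
  have hveq : ∀ z, v z = m ↔ u z = (F z + m).re := by
    intro z
    have h1 := hvle z
    have h2 : m ≤ v z ↔ ((F z + m).re : EReal) ≤ u z := by
      have : (((F z + m).re : ℝ) : EReal) = m - ((-(F z).re : ℝ) : EReal) := by
        rw [← EReal.coe_sub]; simp [add_comm]
      rw [this, EReal.sub_le_iff_le_add (by simp) (by simp)]
    rw [le_antisymm_iff, le_antisymm_iff, h1, h2]
  -- Take a point of largest real part in the compact set where `v = u - re F` is maximal. It lies
  -- in `G`, and `v` is then maximal on a whole circle about it, which contains a point further to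
  -- the right.
  have hEc : IsCompact (closure G ∩ v ⁻¹' Ici (m : EReal)) := hv.isCompact_inter_preimage_Ici hGc _
  obtain ⟨x₁, hx₁, hx₁max⟩ := hEc.exists_isMaxOn ⟨x₀, hx₀, hm.ge⟩
    Complex.continuous_re.continuousOn
  have hall : ∀ z ∈ closure G, v z ≤ m := fun z hz => hm ▸ hmax hz
  have hvx₁ : v x₁ = m := (hall _ hx₁.1).antisymm hx₁.2
  have hx₁G : x₁ ∈ G := by
    by_contra hx₁G
    have h1 : x₁ ∈ frontier G := by rw [hG.frontier_eq]; exact ⟨hx₁.1, hx₁G⟩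
    have h2 := hle _ h1
    rw [(hveq x₁).1 hvx₁] at h2
    have : (F x₁ + m).re ≤ (F x₁).re := by exact_mod_cast h2
    simp at this
    linarith
  obtain ⟨ε, hε, hball⟩ := Metric.isOpen_iff.1 hG x₁ hx₁G
  have hsub : Metric.closedBall x₁ (ε / 2) ⊆ G :=
    (Metric.closedBall_subset_ball (by linarith)).trans hball
  have hs := hu.eq_re_on_sphere hD (half_pos hε) (hsub.trans (subset_closure.trans hGD))
    (F := fun z => F z + m) (((hF.differentiableOn.add_const _).mono hsub).diffContOnCl_ball subset_rfl)
    (fun z hz => (hvle z).1 (hall z (subset_closure (hsub (Metric.sphere_subset_closedBall hz)))))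
    ((hveq x₁).1 hvx₁) (x₁ + (ε / 2 : ℝ)) (by simp [abs_of_pos hε])
  have h1 := hx₁max (show x₁ + (ε / 2 : ℝ) ∈ closure G ∩ v ⁻¹' Ici (m : EReal) from
    ⟨subset_closure (hsub (by simp [abs_of_pos hε])), ((hveq _).2 hs).ge⟩)
  simp at h1
  linarith

end IsSubharmonicOn

/-! ### Inverses of univalent functions. -/

section Inverse
variable {f : ℂ → ℂ} {S : Set ℂ}

theorem isOpen_image_of_injOn (hS : IsOpen S) (hSc : IsPreconnected S)
    (hf : DifferentiableOn ℂ f S) (hinj : InjOn f S) {V : Set ℂ} (hVS : V ⊆ S) (hV : IsOpen V) :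
    IsOpen (f '' V) := by
  rcases (hf.analyticOnNhd hS).is_constant_or_isOpen hSc with ⟨w, hw⟩ | h
  · rcases S.eq_empty_or_nonempty with rfl | ⟨x, hx⟩
    · rw [subset_empty_iff.1 hVS]; simp
    · exfalso
      have h1 : ∀ᶠ z in 𝓝[≠] x, z ∈ S := nhdsWithin_le_nhds (hS.mem_nhds hx)
      obtain ⟨z, hz, hzx⟩ := (h1.and self_mem_nhdsWithin).exists
      exact hzx (hinj hz hx ((hw z hz).trans (hw x hx).symm))
  · exact h V hVS hV

theorem continuousAt_invFunOn (hS : IsOpen S) (hSc : IsPreconnected S)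
    (hf : DifferentiableOn ℂ f S) (hinj : InjOn f S) {z : ℂ} (hz : z ∈ S) :
    ContinuousAt (Function.invFunOn f S) (f z) := by
  intro V hV
  rw [hinj.leftInvOn_invFunOn hz] at hV
  obtain ⟨V', hV'V, hV'o, hzV'⟩ := mem_nhds_iff.1 hV
  have ho := isOpen_image_of_injOn hS hSc hf hinj (V := V' ∩ S) inter_subset_right (hV'o.inter hS)
  refine mem_map.2 (mem_of_superset (ho.mem_nhds ⟨z, ⟨hzV', hz⟩, rfl⟩) ?_)
  rintro _ ⟨x, ⟨hx, hxS⟩, rfl⟩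
  rw [mem_preimage, hinj.leftInvOn_invFunOn hxS]
  exact hV'V hx

theorem hasDerivAt_invFunOn (hS : IsOpen S) (hSc : IsPreconnected S)
    (hf : DifferentiableOn ℂ f S) (hinj : InjOn f S) {z : ℂ} (hz : z ∈ S) (hz' : deriv f z ≠ 0) :
    HasDerivAt (Function.invFunOn f S) (deriv f z)⁻¹ (f z) := by
  have hl := hinj.leftInvOn_invFunOn
  refine HasDerivAt.of_local_left_inverse (f := f) (continuousAt_invFunOn hS hSc hf hinj hz) ?_ hz' ?_
  · rw [hl hz]
    exact (hf.differentiableAt (hS.mem_nhds hz)).hasDerivAt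
  · filter_upwards [(isOpen_image_of_injOn hS hSc hf hinj subset_rfl hS).mem_nhds ⟨z, hz, rfl⟩]
    rintro _ ⟨x, hx, rfl⟩
    rw [hl hx]

/-- Critical points are isolated, since otherwise `f` would be locally constant. The continuous
inverse is then holomorphic off one point, so the singularity is removable, and the chain rule would
give 1 = 0 at a critical point. -/
theorem deriv_ne_zero_of_injOn (hS : IsOpen S) (hSc : IsPreconnected S)
    (hf : DifferentiableOn ℂ f S) (hinj : InjOn f S) {z : ℂ} (hz : z ∈ S) : deriv f z ≠ 0 := by
  intro h0
  have hl := hinj.leftInvOn_invFunOn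
  have hcont := continuousAt_invFunOn hS hSc hf hinj hz
  have hopen := isOpen_image_of_injOn hS hSc hf hinj subset_rfl hS
  have hdiff : DifferentiableAt ℂ (Function.invFunOn f S) (f z) := by
    rcases ((hf.analyticOnNhd hS).deriv z hz).eventually_eq_zero_or_eventually_ne_zero with h | h
    · exfalso
      obtain ⟨ε, hε, hball⟩ := Metric.mem_nhds_iff.1 (h.and (hS.mem_nhds hz))
      have h1 : ∀ x ∈ Metric.ball z ε, f x = f z := fun x hx =>
        Metric.isOpen_ball.is_const_of_deriv_eq_zero (convex_ball z ε).isPreconnected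
          (hf.mono fun y hy => (hball hy).2) (fun y hy => (hball hy).1) hx
          (Metric.mem_ball_self hε)
      have h2 : ∀ᶠ y in 𝓝[≠] z, y ∈ Metric.ball z ε :=
        nhdsWithin_le_nhds (Metric.ball_mem_nhds z hε)
      obtain ⟨y, hy, hyz⟩ := (h2.and self_mem_nhdsWithin).exists
      exact hyz (hinj (hball hy).2 hz (h1 y hy))
    · refine (Complex.analyticAt_of_differentiable_on_punctured_nhds_of_continuousAt ?_
        hcont).differentiableAt
      have h1 : Tendsto (Function.invFunOn f S) (𝓝[≠] f z) (𝓝[≠] z) := by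
        refine tendsto_nhdsWithin_iff.2 ⟨?_, ?_⟩
        · have := hcont.tendsto
          rw [hl hz] at this
          exact this.mono_left nhdsWithin_le_nhds
        · filter_upwards [nhdsWithin_le_nhds (hopen.mem_nhds ⟨z, hz, rfl⟩), self_mem_nhdsWithin]
          rintro _ ⟨x, hx, rfl⟩ hne
          rw [hl hx]
          rintro rfl
          exact hne rfl
      filter_upwards [h1.eventually h, nhdsWithin_le_nhds (hopen.mem_nhds ⟨z, hz, rfl⟩)]
      rintro _ hx' ⟨x, hx, rfl⟩
      rw [hl hx] at hx'
      exact (hasDerivAt_invFunOn hS hSc hf hinj hx hx').differentiableAt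
  have h1 := hdiff.hasDerivAt.comp z (hf.differentiableAt (hS.mem_nhds hz)).hasDerivAt
  have h2 : HasDerivAt (Function.invFunOn f S ∘ f) 1 z :=
    (hasDerivAt_id z).congr_of_eventuallyEq (by
      filter_upwards [hS.mem_nhds hz] with x hx using hl hx)
  have := h1.unique h2
  rw [h0, mul_zero] at this
  exact zero_ne_one this

theorem differentiableOn_invFunOn (hS : IsOpen S) (hSc : IsPreconnected S)
    (hf : DifferentiableOn ℂ f S) (hinj : InjOn f S) :
    DifferentiableOn ℂ (Function.invFunOn f S) (f '' S) := by
  rintro _ ⟨z, hz, rfl⟩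
  exact (hasDerivAt_invFunOn hS hSc hf hinj hz
    (deriv_ne_zero_of_injOn hS hSc hf hinj hz)).differentiableAt.differentiableWithinAt

end Inverse

/-! ### Conformal invariance of subharmonicity. -/

namespace IsSubharmonicOn
variable {u : ℂ → EReal} {D : Set ℂ}

theorem exists_upper_bound (hu : IsSubharmonicOn u D) {A : Set ℂ} (hA : IsCompact A)
    (hAD : A ⊆ D) : ∃ C : ℝ, ∀ z ∈ A, u z ≤ C := by
  rcases A.eq_empty_or_nonempty with rfl | hne
  · exact ⟨0, by simp⟩
  obtain ⟨x, hx, hmax⟩ := (hu.usc.mono hAD).exists_isMaxOn hne hA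
  exact ⟨(u x).toReal, fun z hz => (hmax hz).trans (EReal.le_coe_toReal (hu.lt_top x (hAD hx)).ne)⟩

/-- Subharmonicity is invariant under injective holomorphic changes of variables. -/
theorem comp_injOn {S : Set ℂ} {K : ℂ → ℂ} (hS : IsOpen S) (hSc : IsPreconnected S)
    (hK : DifferentiableOn ℂ K S) (hinj : InjOn K S) (hu : IsSubharmonicOn u (K '' S)) :
    IsSubharmonicOn (u ∘ K) S := by
  have hD : IsOpen (K '' S) := isOpen_image_of_injOn hS hSc hK hinj subset_rfl hS
  have husc : UpperSemicontinuousOn (u ∘ K) S :=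
    hu.usc.comp hK.continuousOn (mapsTo_image K S)
  have hl := hinj.leftInvOn_invFunOn
  have hL := differentiableOn_invFunOn hS hSc hK hinj
  refine ⟨fun w hw => hu.lt_top _ ⟨w, hw, rfl⟩, ?_, husc, ?_⟩
  · obtain ⟨_, ⟨w, hw, rfl⟩, h⟩ := hu.exists_ne_bot
    exact ⟨w, hw, h⟩
  intro c ρ hρ hcS
  have hsS : Metric.sphere c ρ ⊆ S := Metric.sphere_subset_closedBall.trans hcS
  have hbS : Metric.ball c ρ ⊆ S := Metric.ball_subset_closedBall.trans hcS
  obtain ⟨C, hC⟩ := hu.exists_upper_bound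
    ((isCompact_sphere c ρ).image_of_continuousOn (hK.continuousOn.mono hsS)) (image_mono hsS)
  refine le_of_forall_gt_imp_ge_of_dense fun a ha => ?_
  induction a with
  | bot => simp at ha
  | top => exact le_top
  | coe a =>
    -- An entire majorant of `u ∘ K` on the circle, carried over by the inverse of `K`, dominates
    -- `u` on the boundary of the image of the disk. The maximum principle then bounds `u (K c)` by
    -- `re H c`.
    obtain ⟨H, hH, hHu, hHc⟩ := exists_entire_majorant hρ (husc.mono hsS)
      (fun z hz => hC _ ⟨z, hz, rfl⟩) ha
    have hcl : closure (K '' Metric.ball c ρ) ⊆ K '' Metric.closedBall c ρ :=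
      closure_minimal (image_mono Metric.ball_subset_closedBall)
        ((isCompact_closedBall c ρ).image_of_continuousOn (hK.continuousOn.mono hcS)).isClosed
    have hclS : closure (K '' Metric.ball c ρ) ⊆ K '' S := hcl.trans (image_mono hcS)
    have hopen := isOpen_image_of_injOn hS hSc hK hinj hbS Metric.isOpen_ball
    have hF : DifferentiableOn ℂ (fun w => H (Function.invFunOn K S w)) (K '' S) :=
      hH.comp_differentiableOn hL
    have key := hu.le_re_of_frontier_le hD hopen
      (((isCompact_closedBall c ρ).image_of_continuousOn
        (hK.continuousOn.mono hcS)).of_isClosed_subset isClosed_closure hcl) hclS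
      (F := fun w => H (Function.invFunOn K S w))
      ⟨hF.mono (image_mono hbS), hF.continuousOn.mono hclS⟩ ?_ (K c)
      ⟨c, Metric.mem_ball_self hρ, rfl⟩
    · rw [hl (hcS (Metric.mem_closedBall_self hρ.le))] at key
      have h2pi : (0 : EReal) ≤ ((2 * Real.pi : ℝ) : EReal) := by
        exact_mod_cast (by positivity : (0 : ℝ) ≤ 2 * Real.pi)
      refine (mul_le_mul_of_nonneg_left key h2pi).trans ?_
      exact_mod_cast hHc.le
    · intro w hw
      rw [hopen.frontier_eq] at hw
      obtain ⟨z, hz, rfl⟩ := hcl hw.1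
      have hzs : z ∈ Metric.sphere c ρ := by
        rw [← Metric.closedBall_sdiff_ball]
        exact ⟨hz, fun h => hw.2 ⟨z, h, rfl⟩⟩
      rw [hl (hcS hz)]
      exact (hHu z hzs).1.le

end IsSubharmonicOn

/-! ### Rotation invariance of means and the Poisson formula. -/

theorem lintegral_angleMeasure_shift {f : ℝ → ENNReal} (hf : f.Periodic (2 * Real.pi)) (φ : ℝ) :
    ∫⁻ α, f (α + φ) ∂angleMeasure = ∫⁻ α, f α ∂angleMeasure := by
  have h2pi : 0 < 2 * Real.pi := by positivity
  have h1 : ∫⁻ α, f (α + φ) ∂angleMeasure =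
      ∫⁻ α in Ioc (-Real.pi + φ) (-Real.pi + φ + 2 * Real.pi), f α := by
    have hmp := (measurePreserving_add_right volume φ).setLIntegral_comp_emb
      (measurableEmbedding_addRight φ) f (Ioc (-Real.pi) Real.pi)
    rw [hmp]
    congr 2
    rw [image_add_const_Ioc]
    congr 1
    ring
  have : VAddInvariantMeasure (AddSubgroup.zmultiples (2 * Real.pi)) ℝ volume :=
    ⟨fun c s _ => measure_preimage_add _ _ _⟩
  rw [h1, (isAddFundamentalDomain_Ioc h2pi (-Real.pi + φ) volume).setLIntegral_eq
    (isAddFundamentalDomain_Ioc h2pi (-Real.pi) volume) f hf.map_vadd_zmultiples]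
  congr 3
  ring

theorem angleIntegral_shift {g : ℝ → EReal} (hg : g.Periodic (2 * Real.pi)) (φ : ℝ) :
    angleIntegral (fun θ => g (θ + φ)) = angleIntegral g := by
  unfold angleIntegral
  rw [lintegral_angleMeasure_shift (f := fun θ => (g θ).toENNReal) (fun θ => by simp [hg θ]),
    lintegral_angleMeasure_shift (f := fun θ => (-g θ).toENNReal) (fun θ => by simp [hg θ])]

theorem circlePt_add (ρ θ φ : ℝ) :
    circlePt 0 ρ (θ + φ) = Complex.exp (φ * Complex.I) * circlePt 0 ρ θ := by
  simp only [circlePt, zero_add, Complex.ofReal_add, add_mul, Complex.exp_add]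
  ring

theorem periodic_circlePt (c : ℂ) (ρ : ℝ) : (circlePt c ρ).Periodic (2 * Real.pi) :=
  periodic_circleMap c ρ

/-- Integral means over a circle about the origin are invariant under rotations. -/
theorem angleIntegral_rotate (u : ℂ → EReal) (ρ : ℝ) {ε : ℂ} (hε : ‖ε‖ = 1) :
    angleIntegral (fun θ => u (ε * circlePt 0 ρ θ)) =
      angleIntegral fun θ => u (circlePt 0 ρ θ) := by
  have h1 : ε = Complex.exp (ε.arg * Complex.I) := by
    have := Complex.norm_mul_exp_arg_mul_I ε
    rw [hε, Complex.ofReal_one, one_mul] at this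
    exact this.symm
  rw [← angleIntegral_shift (g := fun θ => u (circlePt 0 ρ θ))
    (fun θ => by simp [periodic_circlePt 0 ρ θ]) ε.arg]
  simp only [circlePt_add, ← h1]

theorem ae_eq_toReal_of_angleIntegral_ne_bot {g : ℝ → EReal} {C : ℝ}
    (hg : AEMeasurable g angleMeasure) (hC : ∀ θ, g θ ≤ C) (h : angleIntegral g ≠ ⊥) :
    (∀ᵐ θ ∂angleMeasure, g θ = (g θ).toReal) ∧
      Integrable (fun θ => (g θ).toReal) angleMeasure ∧
      angleIntegral g = ((∫ θ, (g θ).toReal ∂angleMeasure : ℝ) : EReal) := by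
  have hm : AEMeasurable (fun θ => ((C : EReal) - g θ).toENNReal) angleMeasure :=
    (continuous_coe_sub_toENNReal C).measurable.comp_aemeasurable hg
  have hX : ∫⁻ θ, ((C : EReal) - g θ).toENNReal ∂angleMeasure ≠ ⊤ := by
    intro hX
    rw [angleIntegral_eq_sub hg (integrable_const C) (ae_of_all _ hC), hX] at h
    simp at h
  have h1 : ∀ᵐ θ ∂angleMeasure, g θ = (g θ).toReal := by
    filter_upwards [ae_lt_top' hm hX] with θ hθ
    refine (EReal.coe_toReal ((hC θ).trans_lt (EReal.coe_lt_top C)).ne ?_).symm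
    intro hb
    rw [hb] at hθ
    simp at hθ
  have h2 : Integrable (fun θ => C - (g θ).toReal) angleMeasure := by
    refine (integrable_toReal_of_lintegral_ne_top hm hX).congr ?_
    filter_upwards [h1] with θ hθ
    have := hC θ
    rw [hθ] at this ⊢
    rw [← EReal.coe_sub, EReal.real_coe_toENNReal, EReal.toReal_coe, ENNReal.toReal_ofReal]
    have : (g θ).toReal ≤ C := by exact_mod_cast this
    linarith
  have h3 : Integrable (fun θ => (g θ).toReal) angleMeasure := by
    exact ((integrable_const C).sub h2).congr (ae_of_all _ fun θ => by simp)
  refine ⟨h1, h3, ?_⟩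
  rw [← angleIntegral_coe h3]
  unfold angleIntegral
  congr 2
  · exact lintegral_congr_ae (h1.mono fun θ hθ => by simp only; rw [← hθ])
  · exact lintegral_congr_ae (h1.mono fun θ hθ => by simp only; rw [← hθ])

theorem continuousOn_re_kernel {c w : ℂ} {ρ : ℝ} (hw : w ∈ Metric.ball c ρ) :
    ContinuousOn (fun z => ((z - c + (w - c)) / ((z - c) - (w - c))).re) (Metric.sphere c ρ) := by
  refine Complex.continuous_re.comp_continuousOn (ContinuousOn.div (by fun_prop) (by fun_prop) ?_)
  intro z hz h
  rw [sub_sub_sub_cancel_right, sub_eq_zero] at h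
  rw [h, Metric.mem_sphere] at hz
  exact (Metric.mem_ball.1 hw).ne hz

theorem continuous_comp_circlePt {E : Type*} [TopologicalSpace E] {f : ℂ → E} {c : ℂ} {ρ : ℝ}
    (hρ : 0 ≤ ρ) (hf : ContinuousOn f (Metric.sphere c ρ)) :
    Continuous fun θ => f (circlePt c ρ θ) :=
  hf.comp_continuous (continuous_circlePt c ρ) fun θ => circlePt_mem_sphere c hρ θ

theorem continuousOn_sphere_of_diffContOnCl {F : ℂ → ℂ} {c : ℂ} {ρ : ℝ} (hρ : 0 < ρ)
    (hF : DiffContOnCl ℂ F (Metric.ball c ρ)) : ContinuousOn F (Metric.sphere c ρ) := by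
  have := hF.continuousOn
  rw [closure_ball _ hρ.ne'] at this
  exact this.mono Metric.sphere_subset_closedBall

/-- The Poisson formula for the real part of a holomorphic function. -/
theorem integral_kernel_mul_re {F : ℂ → ℂ} {c w : ℂ} {ρ : ℝ}
    (hF : DiffContOnCl ℂ F (Metric.ball c ρ)) (hw : w ∈ Metric.ball c ρ) :
    ∫ θ, ((circlePt c ρ θ - c + (w - c)) / ((circlePt c ρ θ - c) - (w - c))).re *
      (F (circlePt c ρ θ)).re ∂angleMeasure = 2 * Real.pi * (F w).re := by
  have hρ : 0 < ρ := Metric.pos_of_mem_ball hw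
  rw [integral_angleMeasure_eq_circleAverage
    (fun z => ((z - c + (w - c)) / ((z - c) - (w - c))).re * (F z).re)]
  congr 1
  have h1 := hF.circleAverage_re_herglotzRieszKernel_smul' hw
  have h2 := Complex.reCLM.circleAverage_comp_comm (c := c) (R := ρ)
    (f := fun z => ((z - c + (w - c)) / ((z - c) - (w - c))).re • F z)
    (((continuousOn_re_kernel hw).smul
      (continuousOn_sphere_of_diffContOnCl hρ hF)).circleIntegrable hρ.le)
  rw [h1] at h2
  rw [← Complex.reCLM_apply, ← h2]
  congr 1
  ext z
  simp [-Complex.sub_re, -Complex.add_re]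

theorem upperSemicontinuous_comp_path {u : ℂ → EReal} {D : Set ℂ} (hu : UpperSemicontinuousOn u D)
    {X : Type*} [TopologicalSpace X] {γ : X → ℂ} (hγ : Continuous γ) (hD : ∀ t, γ t ∈ D) :
    UpperSemicontinuous fun t => u (γ t) := by
  rw [← upperSemicontinuousOn_univ_iff]
  exact hu.comp hγ.continuousOn fun t _ => hD t

/-! ### Littlewood's inequality and finiteness of circular means. -/

namespace IsSubharmonicOn
variable {u : ℂ → EReal} {D : Set ℂ}

theorem le_re_on_closedBall (hu : IsSubharmonicOn u D) (hD : IsOpen D) {c : ℂ} {ρ : ℝ}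
    (hρ : 0 < ρ) (hcD : Metric.closedBall c ρ ⊆ D) {H : ℂ → ℂ}
    (hH : DiffContOnCl ℂ H (Metric.ball c ρ)) (hle : ∀ z ∈ Metric.sphere c ρ, u z ≤ (H z).re) :
    ∀ z ∈ Metric.closedBall c ρ, u z ≤ (H z).re := by
  intro z hz
  rw [← Metric.ball_union_sphere] at hz
  refine hz.elim (fun h => ?_) (hle z)
  refine hu.le_re_of_frontier_le hD Metric.isOpen_ball ?_ ?_ hH ?_ z h
  · rw [closure_ball _ hρ.ne']; exact isCompact_closedBall c ρ
  · rwa [closure_ball _ hρ.ne']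
  · rwa [frontier_ball _ hρ.ne']

/-- Littlewood's subordination inequality. -/
theorem angleIntegral_comp_le (hu : IsSubharmonicOn u D) (hD : IsOpen D) {r : ℝ} (hr : 0 < r)
    (hrD : Metric.closedBall 0 r ⊆ D) {ω : ℂ → ℂ} (hω : DiffContOnCl ℂ ω (Metric.ball 0 r))
    (hω0 : ω 0 = 0) (hmaps : ∀ z ∈ Metric.sphere 0 r, ω z ∈ Metric.closedBall 0 r) :
    angleIntegral (fun θ => u (ω (circlePt 0 r θ))) ≤
      angleIntegral fun θ => u (circlePt 0 r θ) := by
  have hsD := Metric.sphere_subset_closedBall.trans hrD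
  obtain ⟨C, hC⟩ := hu.exists_upper_bound (isCompact_sphere 0 r) hsD
  have hωc : Continuous fun θ => ω (circlePt 0 r θ) := by
    refine hω.continuousOn.comp_continuous (continuous_circlePt 0 r) fun θ => ?_
    rw [closure_ball _ hr.ne']
    exact Metric.sphere_subset_closedBall (circlePt_mem_sphere 0 hr.le θ)
  have hmem : ∀ θ, ω (circlePt 0 r θ) ∈ Metric.closedBall 0 r := fun θ =>
    hmaps _ (circlePt_mem_sphere 0 hr.le θ)
  refine le_of_forall_gt_imp_ge_of_dense fun a ha => ?_
  induction a with
  | bot => simp at ha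
  | top => exact le_top
  | coe a =>
    -- The bound `u ≤ re H` extends to the closed disk, and the mean of `re (H ∘ ω)` is `2π re H(0)`
    -- because `ω 0 = 0`.
    obtain ⟨H, hH, hHu, hHc⟩ := exists_entire_majorant hr (hu.usc.mono hsD) hC ha
    have hle := hu.le_re_on_closedBall hD hr hrD hH.diffContOnCl fun z hz => (hHu z hz).1.le
    have h1 := angleIntegral_le (g := fun θ => u (ω (circlePt 0 r θ)))
      (q := fun θ => (H (ω (circlePt 0 r θ))).re)
      (upperSemicontinuous_comp_path hu.usc hωc fun θ => hrD (hmem θ)).measurable.aemeasurable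
      (integrable_angleMeasure_of_continuous
        (Complex.continuous_re.comp (hH.continuous.comp hωc)))
      (ae_of_all _ fun θ => hle _ (hmem θ))
    refine h1.trans ?_
    have h2 := integral_re_circlePt (F := fun z => H (ω z)) hr (hH.comp_diffContOnCl hω)
    rw [h2, hω0]
    exact_mod_cast hHc.le

/-- Harnack's inequality: `C + 1 - re H` is positive on the circle for the majorants used, so making
it huge at the centre makes it huge at every interior point. -/
theorem eq_bot_on_ball (hu : IsSubharmonicOn u D) (hD : IsOpen D) {c : ℂ} {ρ : ℝ}
    (hρ : 0 < ρ) (hcD : Metric.closedBall c ρ ⊆ D)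
    (hbot : angleIntegral (fun θ => u (circlePt c ρ θ)) = ⊥) :
    ∀ z ∈ Metric.ball c ρ, u z = ⊥ := by
  intro w hw
  have hsD := Metric.sphere_subset_closedBall.trans hcD
  obtain ⟨C, hC⟩ := hu.exists_upper_bound (isCompact_sphere c ρ) hsD
  have hwρ : ‖w - c‖ < ρ := by rwa [← mem_ball_iff_norm]
  -- This is the minimum over the circle of the Poisson kernel at `w`. The value of `a` chosen below
  -- makes `κ (C + 1 - re H c)` exceed `C + 1 - M`, whence `re H w < M`.
  set κ := (ρ - ‖w - c‖) / (ρ + ‖w - c‖) with hκ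
  have hκ0 : 0 < κ := div_pos (by linarith) (by positivity)
  rw [EReal.eq_bot_iff_forall_lt]
  intro M
  obtain ⟨H, hH, hHu, hHc⟩ := exists_entire_majorant hρ (hu.usc.mono hsD) hC
    (a := 2 * Real.pi * (C + 1 - (C + 1 - M) / κ)) (by rw [hbot]; exact EReal.bot_lt_coe _)
  have hHc' : (H c).re < C + 1 - (C + 1 - M) / κ := lt_of_mul_lt_mul_left hHc (by positivity)
  refine (hu.le_re_on_closedBall hD hρ hcD hH.diffContOnCl (fun z hz => (hHu z hz).1.le) w
    (Metric.ball_subset_closedBall hw)).trans_lt ?_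
  have hG : Differentiable ℂ fun z => (C + 1 : ℂ) - H z := by fun_prop
  have hp := integral_kernel_mul_re (hG.diffContOnCl (s := Metric.ball c ρ)) hw
  have hm := integral_re_circlePt hρ (hG.diffContOnCl (s := Metric.ball c ρ))
  have hGc : Continuous fun θ => ((C + 1 : ℂ) - H (circlePt c ρ θ)).re :=
    Complex.continuous_re.comp (hG.continuous.comp (continuous_circlePt c ρ))
  have hpos : ∀ z ∈ Metric.sphere c ρ, κ * ((C + 1 : ℂ) - H z).re ≤
      ((z - c + (w - c)) / ((z - c) - (w - c))).re * ((C + 1 : ℂ) - H z).re := by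
    intro z hz
    refine mul_le_mul_of_nonneg_right (le_re_herglotzRieszKernel hz hw) ?_
    have := (hHu z hz).2
    simp; linarith
  have h1 : κ * ((C + 1 : ℂ) - H c).re ≤ ((C + 1 : ℂ) - H w).re := by
    have h2 : 2 * Real.pi * (κ * ((C + 1 : ℂ) - H c).re) ≤
        2 * Real.pi * ((C + 1 : ℂ) - H w).re := by
      rw [← hp, mul_left_comm, ← hm, ← integral_const_mul]
      refine integral_mono (integrable_angleMeasure_of_continuous (hGc.const_mul κ))
        (integrable_angleMeasure_of_continuous ?_)
        fun θ => hpos _ (circlePt_mem_sphere c hρ.le θ)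
      exact (continuous_comp_circlePt hρ.le (continuousOn_re_kernel hw)).mul hGc
    exact le_of_mul_le_mul_left h2 (by positivity)
  have h2 : κ * (C + 1 - (H c).re) ≤ C + 1 - (H w).re := by simpa using h1
  have h3 : (C + 1 - M) / κ * κ = C + 1 - M := div_mul_cancel₀ _ hκ0.ne'
  have : (H w).re < M := by nlinarith
  exact_mod_cast this

/-- Otherwise the interior of `{u = -∞}` meets D. It is relatively closed in D: a circle about a
limit point, through a point of this interior, has `u = -∞` on an arc, so its mean is -∞ and `u =
-∞` inside it. By connectedness `u` would be -∞ on all of D. -/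
theorem angleIntegral_ne_bot (hu : IsSubharmonicOn u D) (hD : IsOpen D) (hDc : IsPreconnected D)
    {c : ℂ} {ρ : ℝ} (hρ : 0 < ρ) (hcD : Metric.closedBall c ρ ⊆ D) :
    angleIntegral (fun θ => u (circlePt c ρ θ)) ≠ ⊥ := by
  intro hbot
  have h0 := hu.eq_bot_on_ball hD hρ hcD hbot
  let V : Set ℂ := interior {z | u z = ⊥}
  have hcl : closure V ∩ D ⊆ V := by
    rintro x ⟨hx, hxD⟩
    obtain ⟨ε, hε, hball⟩ := Metric.isOpen_iff.1 hD x hxD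
    obtain ⟨a, haV, hax⟩ := Metric.mem_closure_iff.1 hx ε hε
    rcases eq_or_ne x a with rfl | hne
    · exact haV
    have hd : 0 < dist x a := dist_pos.2 hne
    have hsub : Metric.closedBall x (dist x a) ⊆ D :=
      (Metric.closedBall_subset_ball hax).trans hball
    obtain ⟨θ₀, hθ₀, hθa⟩ := exists_circlePt_eq_of_Ioc (c := x) (z := a) (ρ := dist x a)
      (by rw [Metric.mem_sphere, dist_comm])
    have hm := hu.measurable_circlePt hd.le (Metric.sphere_subset_closedBall.trans hsub)
    have htop : ∫⁻ θ, (-u (circlePt x (dist x a) θ)).toENNReal ∂angleMeasure = ⊤ := by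
      by_contra htop
      obtain ⟨θ, hθ, hlt⟩ := exists_of_ae_angleMeasure (ae_lt_top' hm.neg.ereal_toENNReal htop)
        (isOpen_interior.preimage (continuous_circlePt x (dist x a)) :
          IsOpen (circlePt x (dist x a) ⁻¹' V)) hθ₀ (by rw [mem_preimage, hθa]; exact haV)
      have : u (circlePt x (dist x a) θ) = ⊥ := interior_subset (s := {z | u z = ⊥}) hθ
      simp [this] at hlt
    have hb : angleIntegral (fun θ => u (circlePt x (dist x a) θ)) = ⊥ := by
      unfold angleIntegral
      rw [htop]
      simp
    exact mem_interior.2 ⟨_, hu.eq_bot_on_ball hD hd hsub hb, Metric.isOpen_ball,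
      Metric.mem_ball_self hd⟩
  have hcV : c ∈ V := mem_interior.2 ⟨_, h0, Metric.isOpen_ball, Metric.mem_ball_self hρ⟩
  have hall := hDc.subset_of_closure_inter_subset isOpen_interior
    ⟨c, hcD (Metric.mem_closedBall_self hρ.le), hcV⟩ hcl
  obtain ⟨w, hw, hne⟩ := hu.exists_ne_bot
  exact hne (interior_subset (s := {z | u z = ⊥}) (hall hw))

end IsSubharmonicOn

/-! ### The Poisson majorant and equality in Littlewood's inequality. -/

namespace IsSubharmonicOn
variable {u : ℂ → EReal} {D : Set ℂ}

/-- A subharmonic function on a disk has a harmonic majorant with the same integral mean. -/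
theorem exists_harmonic_majorant (hu : IsSubharmonicOn u D) (hD : IsOpen D)
    (hDc : IsPreconnected D) {r : ℝ} (hr : 0 < r) (hrD : Metric.closedBall 0 r ⊆ D) :
    ∃ F : ℂ → ℂ, DifferentiableOn ℂ F (Metric.ball 0 r) ∧
      (∀ z ∈ Metric.ball 0 r, u z ≤ (F z).re) ∧
      angleIntegral (fun θ => u (circlePt 0 r θ)) = ((2 * Real.pi * (F 0).re : ℝ) : EReal) := by
  have hsD := Metric.sphere_subset_closedBall.trans hrD
  obtain ⟨C, hC⟩ := hu.exists_upper_bound (isCompact_sphere 0 r) hsD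
  have hmeas := hu.measurable_circlePt hr.le hsD
  obtain ⟨hae, hint, heq⟩ := ae_eq_toReal_of_angleIntegral_ne_bot hmeas
    (fun θ => hC _ (circlePt_mem_sphere 0 hr.le θ)) (hu.angleIntegral_ne_bot hD hDc hr hrD)
  set g : ℂ → ℝ := fun z => (u z).toReal with hg
  have hper : (fun θ => g (circlePt 0 r θ)).Periodic (2 * Real.pi) := fun θ => by
    simp [periodic_circlePt 0 r θ]
  have hci : CircleIntegrable g 0 r := by
    have h1 : IntervalIntegrable (fun θ => g (circlePt 0 r θ)) volume (-Real.pi)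
        (-Real.pi + 2 * Real.pi) := by
      rw [intervalIntegrable_iff_integrableOn_Ioc_of_le (by linarith [Real.pi_pos]),
        show -Real.pi + 2 * Real.pi = Real.pi by ring]
      exact hint
    exact hper.intervalIntegrable (by positivity) h1 0 (2 * Real.pi)
  have hci' : CircleIntegrable (fun ζ => (g ζ : ℂ)) 0 r := by
    simp only [CircleIntegrable, intervalIntegrable_iff] at hci ⊢
    exact Complex.ofRealCLM.integrable_comp hci
  -- The Herglotz integral of the boundary values of `u`; its real part is their Poisson integral.
  let F : ℂ → ℂ := fun w =>
    Real.circleAverage (fun ζ => herglotzRieszKernel 0 w ζ • (g ζ : ℂ)) 0 r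
  have hF : DifferentiableOn ℂ F (Metric.ball 0 r) :=
    differentiableOn_circleAverage_herglotzRieszKernel_smul hci'
  have hFre : ∀ w ∈ Metric.ball (0 : ℂ) r, 2 * Real.pi * (F w).re =
      ∫ θ, ((circlePt 0 r θ - 0 + (w - 0)) / ((circlePt 0 r θ - 0) - (w - 0))).re *
        g (circlePt 0 r θ) ∂angleMeasure := by
    intro w hw
    rw [integral_angleMeasure_eq_circleAverage
      (fun z => ((z - 0 + (w - 0)) / ((z - 0) - (w - 0))).re * g z)]
    congr 1
    exact re_circleAverage_herglotzRieszKernel_smul hci hw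
  have hF0 : 2 * Real.pi * (F 0).re = ∫ θ, g (circlePt 0 r θ) ∂angleMeasure := by
    rw [hFre 0 (Metric.mem_ball_self hr)]
    refine integral_congr_ae (ae_of_all _ fun θ => ?_)
    have : circlePt 0 r θ ≠ 0 := by
      have := circlePt_mem_sphere 0 hr.le θ
      rw [mem_sphere_zero_iff_norm] at this
      exact norm_pos_iff.1 (by rw [this]; exact hr)
    simp [this]
  refine ⟨F, hF, fun w hw => ?_, by rw [heq, hF0]⟩
  set κ := (r + ‖w - 0‖) / (r - ‖w - 0‖) with hκ
  have hwr : ‖w - 0‖ < r := by rwa [← mem_ball_iff_norm]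
  have hκ0 : 0 < κ := div_pos (by positivity) (by linarith)
  refine EReal.le_of_forall_lt_iff_le.1 fun y hy => ?_
  have hy' : (F w).re < y := by exact_mod_cast hy
  -- The Poisson kernel at `w` is at most `κ`, so the excess `re H - re F` at `w` is at most `κ`
  -- times the excess at 0. The bound on the mean is chosen to make this less than `y - re F w`.
  obtain ⟨H, hH, hHu, hHc⟩ := exists_entire_majorant hr (hu.usc.mono hsD) hC
    (a := 2 * Real.pi * ((F 0).re + (y - (F w).re) / κ)) (by
      rw [heq, ← hF0]
      have : 0 < (y - (F w).re) / κ := div_pos (by linarith) hκ0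
      exact_mod_cast mul_lt_mul_of_pos_left (by linarith) (by positivity))
  refine (hu.le_re_on_closedBall hD hr hrD hH.diffContOnCl (fun z hz => (hHu z hz).1.le) w
    (Metric.ball_subset_closedBall hw)).trans ?_
  have hHc' : (H 0).re < (F 0).re + (y - (F w).re) / κ := lt_of_mul_lt_mul_left hHc (by positivity)
  have hkc := continuous_comp_circlePt hr.le (continuousOn_re_kernel hw)
  have hHcont : Continuous fun θ => (H (circlePt 0 r θ)).re :=
    Complex.continuous_re.comp (hH.continuous.comp (continuous_circlePt 0 r))
  have hHint := integrable_angleMeasure_of_continuous hHcont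
  have hmain : 2 * Real.pi * ((H w).re - (F w).re) ≤ 2 * Real.pi * (κ * ((H 0).re - (F 0).re)) := by
    have e1 := integral_kernel_mul_re (hH.diffContOnCl (s := Metric.ball 0 r)) hw
    have e2 := integral_re_circlePt hr (hH.diffContOnCl (s := Metric.ball 0 r))
    have hkg : Integrable (fun θ => ((circlePt 0 r θ - 0 + (w - 0)) /
        ((circlePt 0 r θ - 0) - (w - 0))).re * g (circlePt 0 r θ)) angleMeasure := by
      refine hint.bdd_mul hkc.aestronglyMeasurable (c := κ) (ae_of_all _ fun θ => ?_)
      rw [Real.norm_of_nonneg]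
      · exact re_herglotzRieszKernel_le (circlePt_mem_sphere 0 hr.le θ) hw
      · exact (div_nonneg (by linarith) (by positivity)).trans
          (le_re_herglotzRieszKernel (circlePt_mem_sphere 0 hr.le θ) hw)
    rw [mul_sub, mul_left_comm, mul_sub, ← e1, ← e2, hFre w hw, hF0, ← integral_sub _ hkg,
      ← integral_sub hHint hint, ← integral_const_mul]
    · refine integral_mono_ae ((integrable_angleMeasure_of_continuous (hkc.mul hHcont)).sub hkg)
        ((hHint.sub hint).const_mul κ) ?_
      filter_upwards [hae] with θ hθ
      rw [← mul_sub]
      refine mul_le_mul_of_nonneg_right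
        (re_herglotzRieszKernel_le (circlePt_mem_sphere 0 hr.le θ) hw) ?_
      have := (hHu _ (circlePt_mem_sphere 0 hr.le θ)).1
      rw [hθ] at this
      have : g (circlePt 0 r θ) < (H (circlePt 0 r θ)).re := by exact_mod_cast this
      linarith
    · exact integrable_angleMeasure_of_continuous (hkc.mul hHcont)
  have h1 := le_of_mul_le_mul_left hmain (by positivity)
  have h2 : κ * ((H 0).re - (F 0).re) ≤ κ * ((y - (F w).re) / κ) :=
    mul_le_mul_of_nonneg_left (by linarith) hκ0.le
  rw [mul_div_cancel₀ _ hκ0.ne'] at h2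
  exact_mod_cast (by linarith : (H w).re ≤ y)

/-- Equality in Littlewood's inequality for a self-map of the open disk forces harmonicity. -/
theorem eq_re_of_angleIntegral_comp_eq (hu : IsSubharmonicOn u D) (hD : IsOpen D)
    (hDc : IsPreconnected D) {r : ℝ} (hr : 0 < r) (hrD : Metric.closedBall 0 r ⊆ D) {ω : ℂ → ℂ}
    (hω : DiffContOnCl ℂ ω (Metric.ball 0 r)) (hω0 : ω 0 = 0)
    (hmaps : ∀ z ∈ Metric.closedBall 0 r, ω z ∈ Metric.ball 0 r)
    (heq : angleIntegral (fun θ => u (ω (circlePt 0 r θ))) =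
      angleIntegral fun θ => u (circlePt 0 r θ)) :
    ∃ F : ℂ → ℂ, DifferentiableOn ℂ F (Metric.ball 0 r) ∧
      ∀ z ∈ Metric.ball 0 r, u z = (F z).re := by
  obtain ⟨F, hF, hle, hFeq⟩ := hu.exists_harmonic_majorant hD hDc hr hrD
  refine ⟨F, hF, ?_⟩
  have hmem : ∀ θ, ω (circlePt 0 r θ) ∈ Metric.ball 0 r := fun θ =>
    hmaps _ (Metric.sphere_subset_closedBall (circlePt_mem_sphere 0 hr.le θ))
  have hωc : Continuous fun θ => ω (circlePt 0 r θ) :=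
    continuous_comp_circlePt hr.le (continuousOn_sphere_of_diffContOnCl hr hω)
  have hFω : DiffContOnCl ℂ (fun z => F (ω z)) (Metric.ball 0 r) := by
    refine ⟨hF.comp hω.differentiableOn fun z hz => hmaps z (Metric.ball_subset_closedBall hz), ?_⟩
    refine hF.continuousOn.comp hω.continuousOn fun z hz => ?_
    rw [closure_ball _ hr.ne'] at hz
    exact hmaps z hz
  -- Both means equal `2π re F(0)`, so `u = re F` at ω of almost every boundary point. These points
  -- are interior, and one contact point suffices.
  have hae := angleIntegral_eq_of_le (g := fun θ => u (ω (circlePt 0 r θ)))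
    (q := fun θ => (F (ω (circlePt 0 r θ))).re)
    (upperSemicontinuous_comp_path hu.usc hωc
      fun θ => hrD (Metric.ball_subset_closedBall (hmem θ))).measurable.aemeasurable
    (integrable_angleMeasure_of_continuous (Complex.continuous_re.comp
      (continuous_comp_circlePt hr.le (continuousOn_sphere_of_diffContOnCl hr hFω))))
    (ae_of_all _ fun θ => hle _ (hmem θ))
    (by rw [heq, hFeq, integral_re_circlePt hr hFω, hω0])
  obtain ⟨θ, -, hθ⟩ := exists_of_ae_angleMeasure hae isOpen_univ
    (right_mem_Ioc.2 (by linarith [Real.pi_pos])) (mem_univ _)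
  exact hu.eq_re_of_isPreconnected hD Metric.isOpen_ball (convex_ball 0 r).isPreconnected
    (Metric.ball_subset_closedBall.trans hrD) hF hle (hmem θ) hθ

end IsSubharmonicOn

/-! ### The boundary mean of a subharmonic function that is harmonic inside the disk. -/

/-- `F` lives only on the open disk, but `F ∘ ω` is continuous up to the circle, since `ω` maps the
closed disk inside. -/
theorem integral_re_comp_circlePt {F ω : ℂ → ℂ} {r : ℝ} (hr : 0 < r)
    (hF : DifferentiableOn ℂ F (Metric.ball 0 r)) (hω : DiffContOnCl ℂ ω (Metric.ball 0 r))
    (hω0 : ω 0 = 0) (hmaps : ∀ z ∈ Metric.closedBall 0 r, ω z ∈ Metric.ball 0 r) :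
    Integrable (fun θ => (F (ω (circlePt 0 r θ))).re) angleMeasure ∧
      ∫ θ, (F (ω (circlePt 0 r θ))).re ∂angleMeasure = 2 * Real.pi * (F 0).re := by
  have hFω : DiffContOnCl ℂ (fun z => F (ω z)) (Metric.ball 0 r) := by
    refine ⟨hF.comp hω.differentiableOn fun z hz => hmaps z (Metric.ball_subset_closedBall hz), ?_⟩
    refine hF.continuousOn.comp hω.continuousOn fun z hz => ?_
    rw [closure_ball _ hr.ne'] at hz
    exact hmaps z hz
  refine ⟨integrable_angleMeasure_of_continuous (Complex.continuous_re.comp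
      (continuous_comp_circlePt hr.le (continuousOn_sphere_of_diffContOnCl hr hFω))), ?_⟩
  rw [integral_re_circlePt hr hFω, hω0]

/-- Here cos α < -1/2, so the squared norm is below r² - rδ + δ² < r². Thus one sixth of every small
circle about a boundary point lies inside the disk, independently of δ. -/
theorem norm_add_circlePt_lt {r δ α : ℝ} (hδ : 0 < δ) (hδr : δ < r)
    (hα : α ∈ Ioc (2 * Real.pi / 3) Real.pi) : ‖circlePt (r : ℂ) δ α‖ < r := by
  have hcos : Real.cos α < -1 / 2 := by
    have h1 : Real.cos (2 * Real.pi / 3) = -1 / 2 := by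
      rw [show 2 * Real.pi / 3 = Real.pi - Real.pi / 3 by ring, Real.cos_pi_sub,
        Real.cos_pi_div_three]
      ring
    rw [← h1]
    exact Real.cos_lt_cos_of_nonneg_of_le_pi (by positivity) hα.2 hα.1
  have h2 : ‖circlePt (r : ℂ) δ α‖ ^ 2 = r ^ 2 + 2 * r * δ * Real.cos α + δ ^ 2 := by
    rw [← Complex.normSq_eq_norm_sq, Complex.normSq_apply]
    have hre : (circlePt (r : ℂ) δ α).re = r + δ * Real.cos α := by
      simp [circlePt, Complex.exp_ofReal_mul_I_re]
    have him : (circlePt (r : ℂ) δ α).im = δ * Real.sin α := by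
      simp [circlePt, Complex.exp_ofReal_mul_I_im]
    rw [hre, him]
    nlinarith [Real.sin_sq_add_cos_sq α]
  have hr : 0 < r := hδ.trans hδr
  have h3 : r * δ * Real.cos α < r * δ * (-1 / 2) := mul_lt_mul_of_pos_left hcos (by positivity)
  have h4 : δ * δ < r * δ := mul_lt_mul_of_pos_right hδr hδ
  refine lt_of_pow_lt_pow_left₀ 2 hr.le ?_
  rw [h2]
  nlinarith

theorem lintegral_le_of_le_angleIntegral {g : ℝ → EReal} {C x : ℝ}
    (hg : AEMeasurable g angleMeasure) (hC : ∀ θ, g θ ≤ C) (h : (x : EReal) ≤ angleIntegral g) :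
    ∫⁻ θ, ((C : EReal) - g θ).toENNReal ∂angleMeasure ≤ ENNReal.ofReal (2 * Real.pi * C - x) := by
  rw [angleIntegral_eq_sub hg (integrable_const C) (ae_of_all _ hC),
    integral_angleMeasure_const] at h
  generalize (∫⁻ θ, ((C : EReal) - g θ).toENNReal ∂angleMeasure) = y at h ⊢
  by_cases hy : y = ⊤
  · rw [hy] at h; simp at h
  · lift y to NNReal using hy
    have : (((y : ENNReal)) : EReal) = ((y : ℝ) : EReal) := rfl
    rw [this, ← EReal.coe_sub, EReal.coe_le_coe_iff] at h
    rw [← ENNReal.ofReal_coe_nnreal]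
    exact ENNReal.ofReal_le_ofReal (by linarith)

theorem le_lintegral_of_angleIntegral_le {g : ℝ → EReal} {C x : ℝ}
    (hg : AEMeasurable g angleMeasure) (hC : ∀ θ, g θ ≤ C) (h : angleIntegral g ≤ x) :
    ENNReal.ofReal (2 * Real.pi * C - x) ≤ ∫⁻ θ, ((C : EReal) - g θ).toENNReal ∂angleMeasure := by
  rw [angleIntegral_eq_sub hg (integrable_const C) (ae_of_all _ hC),
    integral_angleMeasure_const] at h
  generalize (∫⁻ θ, ((C : EReal) - g θ).toENNReal ∂angleMeasure) = y at h ⊢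
  by_cases hy : y = ⊤
  · rw [hy]; exact le_top
  · lift y to NNReal using hy
    have : (((y : ENNReal)) : EReal) = ((y : ℝ) : EReal) := rfl
    rw [this, ← EReal.coe_sub, EReal.coe_le_coe_iff] at h
    rw [← ENNReal.ofReal_coe_nnreal]
    exact ENNReal.ofReal_le_ofReal (by linarith)

namespace IsSubharmonicOn
variable {u : ℂ → EReal} {D : Set ℂ}

/-- Upper semicontinuity of integral means in the radius. -/
theorem exists_forall_angleIntegral_lt (hu : IsSubharmonicOn u D) (hD : IsOpen D) {r : ℝ}
    (hr : 0 < r) (hrD : Metric.closedBall 0 r ⊆ D) {a : ℝ}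
    (ha : angleIntegral (fun θ => u (circlePt 0 r θ)) < a) :
    ∃ δ > 0, ∀ w : ℂ, |‖w‖ - r| < δ →
      angleIntegral (fun θ => u (w * circlePt 0 1 θ)) < a ∧ ∀ θ, w * circlePt 0 1 θ ∈ D := by
  have hsD := Metric.sphere_subset_closedBall.trans hrD
  obtain ⟨C, hC⟩ := hu.exists_upper_bound (isCompact_sphere 0 r) hsD
  obtain ⟨H, hH, hHu, hHc⟩ := exists_entire_majorant hr (hu.usc.mono hsD) hC ha
  -- The majorant still dominates `u` near the circle, and the mean of `re H` over a circle about 0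
  -- does not depend on the radius.
  let V : Set ℂ := interior {z | z ∈ D ∧ u z < (H z).re}
  have hsV : Metric.sphere 0 r ⊆ V := by
    intro z hz
    obtain ⟨y, hy1, hy2⟩ := EReal.lt_iff_exists_real_btwn.1 (hHu z hz).1
    have hHz : ContinuousAt (fun z => (H z).re) z :=
      Complex.continuous_re.continuousAt.comp hH.continuous.continuousAt
    rw [mem_interior_iff_mem_nhds]
    filter_upwards [hD.mem_nhds (hsD hz), hu.eventually_lt hD (hsD hz) hy1,
      hHz.eventually_const_lt (show y < _ from by exact_mod_cast hy2)] with x h1 h2 h3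
    exact ⟨h1, h2.trans (by exact_mod_cast h3)⟩
  obtain ⟨δ, hδ, hth⟩ := (isCompact_sphere (0 : ℂ) r).exists_thickening_subset_open
    isOpen_interior hsV
  refine ⟨min δ r, lt_min hδ hr, fun w hw => ?_⟩
  have hw0 : 0 < ‖w‖ := by
    have := (abs_lt.1 (hw.trans_le (min_le_right _ _))).1
    linarith
  have hmem : ∀ θ, w * circlePt 0 1 θ ∈ D ∧ u (w * circlePt 0 1 θ) < (H (w * circlePt 0 1 θ)).re := by
    intro θ
    refine interior_subset (s := {z | z ∈ D ∧ u z < (H z).re}) (hth ?_)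
    have hn : ‖circlePt 0 1 θ‖ = 1 := by
      simpa using circlePt_mem_sphere 0 zero_le_one θ
    rw [Metric.mem_thickening_iff]
    refine ⟨((r / ‖w‖ : ℝ) : ℂ) * (w * circlePt 0 1 θ), ?_, ?_⟩
    · simp only [mem_sphere_zero_iff_norm, norm_mul, hn, Complex.norm_real, mul_one]
      rw [Real.norm_of_nonneg (by positivity), div_mul_cancel₀ _ hw0.ne']
    · rw [dist_eq_norm, ← one_sub_mul, norm_mul, norm_mul, hn, mul_one, ← Complex.ofReal_one,
        ← Complex.ofReal_sub, Complex.norm_real, Real.norm_eq_abs, ← abs_of_pos hw0, ← abs_mul,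
        abs_of_pos hw0, sub_mul, one_mul, div_mul_cancel₀ _ hw0.ne']
      exact hw.trans_le (min_le_left _ _)
  refine ⟨?_, fun θ => (hmem θ).1⟩
  have hc : Continuous fun θ => w * circlePt 0 1 θ := (continuous_circlePt 0 1).const_mul w
  have h1 := angleIntegral_le (g := fun θ => u (w * circlePt 0 1 θ))
    (q := fun θ => (H (w * circlePt 0 1 θ)).re)
    (upperSemicontinuous_comp_path hu.usc hc fun θ => (hmem θ).1).measurable.aemeasurable
    (integrable_angleMeasure_of_continuous (Complex.continuous_re.comp (hH.continuous.comp hc)))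
    (ae_of_all _ fun θ => (hmem θ).2.le)
  have h2 := integral_re_circlePt (F := fun z => H (w * z)) (c := 0) one_pos
    (hH.comp (differentiable_id.const_mul w)).diffContOnCl
  rw [h2, mul_zero] at h1
  exact h1.trans_lt (by exact_mod_cast hHc)

/-- If `u` agrees with `re F` inside a disk, then the mean of `u` over the boundary circle is at
most the value at the centre. -/
theorem angleIntegral_le_of_eq_re (hu : IsSubharmonicOn u D) (hD : IsOpen D) {r : ℝ}
    (hr : 0 < r) (hrD : Metric.closedBall 0 r ⊆ D) {F : ℂ → ℂ}
    (hF : DifferentiableOn ℂ F (Metric.ball 0 r)) (heq : ∀ z ∈ Metric.ball 0 r, u z = (F z).re) :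
    angleIntegral (fun θ => u (circlePt 0 r θ)) ≤ ((2 * Real.pi * (F 0).re : ℝ) : EReal) := by
  by_contra! hlt
  have hpi := Real.pi_pos
  obtain ⟨R, hR, hRD⟩ : ∃ R > r, Metric.closedBall 0 R ⊆ D := by
    obtain ⟨δ, hδ, h⟩ := (isCompact_closedBall (0 : ℂ) r).exists_cthickening_subset_open hD hrD
    refine ⟨r + δ, by linarith, ?_⟩
    rwa [cthickening_closedBall hδ.le hr.le, add_comm] at h
  obtain ⟨C₀, hC₀⟩ := hu.exists_upper_bound (isCompact_closedBall 0 R) hRD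
  set C := C₀ + 1 with hCdef
  have hC : ∀ z ∈ Metric.closedBall 0 R, u z ≤ C := fun z hz =>
    (hC₀ z hz).trans (by exact_mod_cast (by linarith : C₀ ≤ C))
  have hrR : ∀ θ, circlePt 0 r θ ∈ Metric.closedBall 0 R := fun θ =>
    Metric.closedBall_subset_closedBall hR.le (Metric.sphere_subset_closedBall
      (circlePt_mem_sphere 0 hr.le θ))
  have hsD := Metric.sphere_subset_closedBall.trans hrD
  have hmeas := hu.measurable_circlePt hr.le hsD
  have hle₀ := angleIntegral_le hmeas (integrable_const C₀) (ae_of_all _ fun θ => hC₀ _ (hrR θ))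
  rw [integral_angleMeasure_const] at hle₀
  obtain ⟨M, hM⟩ : ∃ M : ℝ, angleIntegral (fun θ => u (circlePt 0 r θ)) = M :=
    ⟨_, (EReal.coe_toReal (hle₀.trans_lt (EReal.coe_lt_top _)).ne
      ((bot_le.trans_lt hlt)).ne').symm⟩
  rw [hM] at hlt hle₀
  set M₀ := 2 * Real.pi * (F 0).re with hM₀
  have hlt' : M₀ < M := by exact_mod_cast hlt
  have hle₀' : M ≤ 2 * Real.pi * C₀ := by exact_mod_cast hle₀
  -- Averaging the sub-mean inequality for circles of radius δ about all points of |z| = r expresses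
  -- `2πM` through means over circles about 0 of radius `|r + δ e^{iα}|`. Those are `M₀` for α in an
  -- interval of length π/3 and at most `a` otherwise, giving `2πM ≤ 2πa - (π/3)(a - M₀)`. Since
  -- `2π(a - M) ≤ (π/3)(M - M₀)` by the factor 6 and `M < a`, this is impossible. The cap 1 ensures
  -- `a ≤ 2πC`.
  set a := M + min ((M - M₀) / 6) 1 with ha
  have ha1 : a ≤ M + (M - M₀) / 6 := by rw [ha]; gcongr; exact min_le_left _ _
  have ha2 : a ≤ M + 1 := by rw [ha]; gcongr; exact min_le_right _ _
  have ha3 : M < a := by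
    have : 0 < min ((M - M₀) / 6) 1 := lt_min (by linarith) one_pos
    linarith
  have haC : a ≤ 2 * Real.pi * C := by
    have := Real.pi_gt_three
    rw [hCdef]; nlinarith
  obtain ⟨δ₀, hδ₀, hnear⟩ := hu.exists_forall_angleIntegral_lt hD hr hrD (a := a)
    (by rw [hM]; exact_mod_cast ha3)
  obtain ⟨δ, hδ, hδ1, hδ2, hδ3⟩ : ∃ δ : ℝ, 0 < δ ∧ δ < r ∧ δ < δ₀ ∧ r + δ < R := by
    refine ⟨min (r / 2) (min (δ₀ / 2) ((R - r) / 2)), ?_, ?_, ?_, ?_⟩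
    · exact lt_min (by linarith) (lt_min (by linarith) (by linarith))
    · exact (min_le_left _ _).trans_lt (by linarith)
    · exact ((min_le_right _ _).trans (min_le_left _ _)).trans_lt (by linarith)
    · have := (min_le_right (r / 2) (min (δ₀ / 2) ((R - r) / 2))).trans (min_le_right _ _)
      linarith
  -- the nonnegative superharmonic function `C - u`
  let W : ℂ → ENNReal := fun z => ((C : EReal) - u z).toENNReal
  have hn1 : ∀ θ, ‖circlePt 0 1 θ‖ = 1 := fun θ => by
    simpa using circlePt_mem_sphere 0 zero_le_one θ
  have hmean : ∀ w : ℂ, ‖w‖ < R → ∀ x : ℝ, angleIntegral (fun θ => u (w * circlePt 0 1 θ)) ≤ x →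
      ENNReal.ofReal (2 * Real.pi * C - x) ≤ ∫⁻ θ, W (w * circlePt 0 1 θ) ∂angleMeasure := by
    intro w hw x hx
    have hmem : ∀ θ, w * circlePt 0 1 θ ∈ Metric.closedBall 0 R := fun θ => by
      rw [mem_closedBall_zero_iff, norm_mul, hn1, mul_one]; exact hw.le
    exact le_lintegral_of_angleIntegral_le (upperSemicontinuous_comp_path hu.usc
      ((continuous_circlePt 0 1).const_mul w) fun θ => hRD (hmem θ)).measurable.aemeasurable
      (fun θ => hC _ (hmem θ)) hx
  -- averaging the sub-mean value inequality over the circle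
  have hcirc : ∀ φ α, circlePt (circlePt 0 r φ) δ (α + φ) = circlePt r δ α * circlePt 0 1 φ := by
    intro φ α
    simp only [circlePt, Complex.ofReal_add, add_mul, Complex.exp_add, Complex.ofReal_one]
    ring
  have hball : ∀ α φ, circlePt r δ α * circlePt 0 1 φ ∈ Metric.closedBall 0 R := by
    intro α φ
    rw [mem_closedBall_zero_iff, norm_mul, hn1, mul_one]
    have h1 : ‖circlePt (r : ℂ) δ α - r‖ = δ := by
      rw [← mem_sphere_iff_norm]
      exact circlePt_mem_sphere _ hδ.le α
    have h2 := norm_le_norm_add_norm_sub' (circlePt (r : ℂ) δ α) r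
    rw [h1, Complex.norm_real, Real.norm_of_nonneg hr.le] at h2
    linarith
  have hsup : ∀ φ, ∫⁻ α, W (circlePt r δ α * circlePt 0 1 φ) ∂angleMeasure ≤
      ENNReal.ofReal (2 * Real.pi) * W (circlePt 0 r φ) := by
    intro φ
    set c := circlePt 0 r φ with hc
    have hcR : Metric.closedBall c δ ⊆ Metric.closedBall 0 R := by
      have h1 := circlePt_mem_sphere 0 hr.le φ
      rw [← hc, Metric.mem_sphere] at h1
      exact Metric.closedBall_subset_closedBall' (by rw [h1]; linarith)
    have hcs : ∀ α, circlePt c δ α ∈ Metric.closedBall 0 R := fun α =>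
      hcR (Metric.sphere_subset_closedBall (circlePt_mem_sphere c hδ.le α))
    have hshift := lintegral_angleMeasure_shift (f := fun α => W (circlePt c δ α))
      (fun α => by simp [periodic_circlePt c δ α]) φ
    simp only [hc, hcirc] at hshift
    rw [hshift]
    have hsub := hu.submean c δ hδ (hcR.trans hRD)
    have hm := hu.measurable_circlePt (c := c) hδ.le
      (Metric.sphere_subset_closedBall.trans (hcR.trans hRD))
    have hcC : u c ≤ C := hC c (hrR φ)
    rcases eq_or_ne (u c) ⊥ with hbot | hbot
    · simp only [W, hbot]
      simp [ENNReal.mul_top, hpi]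
    · have hx := EReal.coe_toReal (hcC.trans_lt (EReal.coe_lt_top C)).ne hbot
      rw [← hx, ← EReal.coe_mul] at hsub
      refine (lintegral_le_of_le_angleIntegral hm (fun α => hC _ (hcs α)) hsub).trans_eq ?_
      simp only [W]
      rw [← hx, ← EReal.coe_sub, EReal.real_coe_toENNReal, ← ENNReal.ofReal_mul (by positivity),
        EReal.toReal_coe]
      congr 1
      ring
  have htot : ∫⁻ φ, W (circlePt 0 r φ) ∂angleMeasure = ENNReal.ofReal (2 * Real.pi * C - M) := by
    exact le_antisymm (lintegral_le_of_le_angleIntegral hmeas (fun θ => hC _ (hrR θ)) hM.ge)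
      (le_lintegral_of_angleIntegral_le hmeas (fun θ => hC _ (hrR θ)) hM.le)
  have hlow : ENNReal.ofReal (2 * Real.pi * (2 * Real.pi * C - a) + Real.pi / 3 * (a - M₀)) ≤
      ∫⁻ α, ∫⁻ φ, W (circlePt r δ α * circlePt 0 1 φ) ∂angleMeasure ∂angleMeasure := by
    set A : Set ℝ := Ioc (2 * Real.pi / 3) Real.pi with hA
    have hvol : angleMeasure A = ENNReal.ofReal (Real.pi / 3) := by
      rw [Measure.restrict_apply measurableSet_Ioc, inter_eq_left.2
        (Ioc_subset_Ioc_left (by linarith)), Real.volume_Ioc]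
      congr 1
      ring
    have hdist : ∀ α, |‖circlePt (r : ℂ) δ α‖ - r| ≤ δ := by
      intro α
      have h1 : ‖circlePt (r : ℂ) δ α - r‖ = δ := by
        rw [← mem_sphere_iff_norm]
        exact circlePt_mem_sphere _ hδ.le α
      have h2 := abs_norm_sub_norm_le (circlePt (r : ℂ) δ α) r
      rwa [h1, Complex.norm_real, Real.norm_of_nonneg hr.le] at h2
    have hpt : ∀ α, ENNReal.ofReal (2 * Real.pi * C - a) +
        A.indicator (fun _ => ENNReal.ofReal (a - M₀)) α ≤
          ∫⁻ φ, W (circlePt r δ α * circlePt 0 1 φ) ∂angleMeasure := by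
      intro α
      have hwR : ‖circlePt (r : ℂ) δ α‖ < R := by
        have := (abs_le.1 (hdist α)).2
        linarith
      by_cases hα : α ∈ A
      · rw [indicator_of_mem hα, ← ENNReal.ofReal_add (by linarith) (by linarith)]
        have hw := norm_add_circlePt_lt hδ hδ1 hα
        obtain ⟨h1, h2⟩ := integral_re_comp_circlePt one_pos
          (ω := fun z => (r : ℂ)⁻¹ * circlePt r δ α * z) (F := fun z => F (r * z))
          (hF.comp (by fun_prop) fun z hz => by
            rw [mem_ball_zero_iff] at hz ⊢
            rw [norm_mul, Complex.norm_real, Real.norm_of_nonneg hr.le]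
            exact mul_lt_of_lt_one_right hr hz)
          (by fun_prop : Differentiable ℂ fun z : ℂ => (r : ℂ)⁻¹ * circlePt r δ α * z).diffContOnCl
          (by simp) (fun z hz => by
            rw [mem_closedBall_zero_iff] at hz
            rw [mem_ball_zero_iff, norm_mul, norm_mul, norm_inv, Complex.norm_real,
              Real.norm_of_nonneg hr.le]
            refine (mul_le_of_le_one_right (by positivity) hz).trans_lt ?_
            rwa [inv_mul_lt_iff₀ hr, mul_one])
        have hr' : (r : ℂ) ≠ 0 := by exact_mod_cast hr.ne'
        simp only [mul_assoc, mul_inv_cancel_left₀ hr', mul_zero] at h1 h2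
        have h3 := angleIntegral_coe h1
        rw [h2, ← mul_assoc, ← hM₀] at h3
        refine le_trans (le_of_eq ?_) (hmean (circlePt r δ α) hwR M₀ ?_)
        · congr 1; ring
        · rw [← h3]
          refine le_of_eq (congrArg angleIntegral (funext fun θ => heq _ ?_))
          rwa [mem_ball_zero_iff, norm_mul, hn1, mul_one]
      · rw [indicator_of_notMem hα, add_zero]
        exact hmean _ hwR a (hnear _ ((hdist α).trans_lt hδ2)).1.le
    refine le_trans (le_of_eq ?_) (lintegral_mono hpt)
    rw [lintegral_add_left measurable_const, lintegral_const,
      lintegral_indicator_const measurableSet_Ioc, hvol, Measure.restrict_apply_univ,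
      Real.volume_Ioc, ← ENNReal.ofReal_mul (by linarith), ← ENNReal.ofReal_mul (by linarith),
      ← ENNReal.ofReal_add (mul_nonneg (by linarith) (by linarith))
        (mul_nonneg (by linarith) (by linarith))]
    congr 1
    ring
  have hswap : ∫⁻ α, ∫⁻ φ, W (circlePt r δ α * circlePt 0 1 φ) ∂angleMeasure ∂angleMeasure =
      ∫⁻ φ, ∫⁻ α, W (circlePt r δ α * circlePt 0 1 φ) ∂angleMeasure ∂angleMeasure := by
    refine lintegral_lintegral_swap (Measurable.aemeasurable ?_)
    refine (continuous_coe_sub_toENNReal C).measurable.comp ?_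
    refine (upperSemicontinuous_comp_path hu.usc (X := ℝ × ℝ)
      (γ := fun p => circlePt r δ p.1 * circlePt 0 1 p.2) ?_
      fun p => hRD (hball p.1 p.2)).measurable
    exact ((continuous_circlePt r δ).comp continuous_fst).mul
      ((continuous_circlePt 0 1).comp continuous_snd)
  have hfin : ENNReal.ofReal (2 * Real.pi * (2 * Real.pi * C - a) + Real.pi / 3 * (a - M₀)) ≤
      ENNReal.ofReal (2 * Real.pi * (2 * Real.pi * C - M)) := by
    refine hlow.trans ?_
    rw [hswap, ENNReal.ofReal_mul (by positivity), ← htot, ← lintegral_const_mul' _ _ ENNReal.ofReal_ne_top]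
    exact lintegral_mono hsup
  rw [ENNReal.ofReal_le_ofReal_iff (mul_nonneg (by positivity) (by linarith))] at hfin
  nlinarith

end IsSubharmonicOn

/-! ### Starlike functions and convexity of the Alexander transform. -/

/-- First-order condition at a maximum over a closed disk centred at the origin. -/
theorem mul_nonneg_of_isMaxOn_closedBall {L : ℂ → ℝ} {L' : ℂ →L[ℝ] ℝ} {d z₀ : ℂ}
    (hL : HasFDerivAt L L' z₀) (hd : ∀ v, L' v = (d * v).re)
    (hmax : IsMaxOn L (Metric.closedBall 0 ‖z₀‖) z₀) : ∃ κ : ℝ, 0 ≤ κ ∧ d * z₀ = κ := by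
  have key : ∀ y ∈ Metric.closedBall (0 : ℂ) ‖z₀‖, (d * y).re ≤ (d * z₀).re := by
    intro y hy
    have h1 : y - z₀ ∈ posTangentConeAt (Metric.closedBall (0 : ℂ) ‖z₀‖) z₀ := by
      refine mem_posTangentConeAt_of_segment_subset ?_
      rw [add_sub_cancel]
      exact (convex_closedBall 0 ‖z₀‖).segment_subset (by simp) hy
    have h2 := hmax.localize.hasFDerivWithinAt_nonpos hL.hasFDerivWithinAt h1
    rw [hd, mul_sub, Complex.sub_re] at h2
    linarith
  have h3 : ‖d * z₀‖ ≤ (d * z₀).re := by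
    rcases eq_or_ne d 0 with rfl | hd0
    · simp
    have hdn : (‖d‖ : ℂ) ≠ 0 := by simpa using hd0
    -- This point of the disk maximises `re (d y)`, with value `|d| |z₀|`; hence `d z₀` equals its
    -- own modulus.
    have := key ((starRingEnd ℂ) d / ‖d‖ * ‖z₀‖) (by simp [hd0])
    have e : d * ((starRingEnd ℂ) d / ‖d‖ * ‖z₀‖) = ((‖d‖ * ‖z₀‖ : ℝ) : ℂ) := by
      have := Complex.mul_conj' d
      push_cast
      field_simp
      linear_combination (‖z₀‖ : ℂ) * this
    rw [e, Complex.ofReal_re] at this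
    rwa [norm_mul]
  have h4 : (d * z₀).re = ‖d * z₀‖ := le_antisymm (Complex.re_le_norm _) h3
  refine ⟨‖d * z₀‖, norm_nonneg _, ?_⟩
  exact (Complex.re_eq_norm.1 h4).elim fun h5 h6 => by
    apply Complex.ext
    · simpa using h4
    · simpa using h6.symm

/-- A univalent function on the unit disk, vanishing at the origin, with starlike image. -/
structure IsStarlikeUnivalent (h : ℂ → ℂ) : Prop where
  differentiableOn : DifferentiableOn ℂ h (Metric.ball 0 1)
  injOn : InjOn h (Metric.ball 0 1)
  map_zero : h 0 = 0
  star : ∀ z ∈ Metric.ball (0 : ℂ) 1, ∀ t ∈ Icc (0 : ℝ) 1, (t : ℂ) * h z ∈ h '' Metric.ball 0 1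

theorem isPreconnected_unitBall : IsPreconnected (Metric.ball (0 : ℂ) 1) :=
  (convex_ball 0 1).isPreconnected

/-- A function subordinate to a univalent `h` factors through a Schwarz function. -/
theorem exists_schwarz_of_mapsTo {h p : ℂ → ℂ} (hd : DifferentiableOn ℂ h (Metric.ball 0 1))
    (hinj : InjOn h (Metric.ball 0 1)) (h0 : h 0 = 0) (hp : DifferentiableOn ℂ p (Metric.ball 0 1))
    (hp0 : p 0 = 0) (hm : ∀ z ∈ Metric.ball (0 : ℂ) 1, p z ∈ h '' Metric.ball 0 1) :
    ∃ ψ : ℂ → ℂ, DifferentiableOn ℂ ψ (Metric.ball 0 1) ∧ ψ 0 = 0 ∧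
      (∀ z ∈ Metric.ball (0 : ℂ) 1, ψ z ∈ Metric.ball (0 : ℂ) 1 ∧ ‖ψ z‖ ≤ ‖z‖ ∧ h (ψ z) = p z) := by
  have hz0 : (0 : ℂ) ∈ Metric.ball (0 : ℂ) 1 := Metric.mem_ball_self one_pos
  have hψ : DifferentiableOn ℂ (fun z => Function.invFunOn h (Metric.ball 0 1) (p z))
      (Metric.ball 0 1) :=
    (differentiableOn_invFunOn Metric.isOpen_ball isPreconnected_unitBall hd hinj).comp hp hm
  have hψ0 : Function.invFunOn h (Metric.ball 0 1) (p 0) = 0 := by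
    have := hinj.leftInvOn_invFunOn hz0
    rw [h0] at this
    rw [hp0, this]
  have hmaps : ∀ z ∈ Metric.ball (0 : ℂ) 1,
      Function.invFunOn h (Metric.ball 0 1) (p z) ∈ Metric.ball (0 : ℂ) 1 := fun z hz =>
    Function.invFunOn_mem (hm z hz)
  refine ⟨_, hψ, hψ0, fun z hz => ⟨hmaps z hz, ?_, Function.invFunOn_eq (hm z hz)⟩⟩
  exact Complex.norm_le_norm_of_mapsTo_ball hψ
    (fun w hw => Metric.ball_subset_closedBall (hmaps w hw)) hψ0 (by simpa using hz)

/-- Equality in the Schwarz lemma. -/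
theorem exists_rotation_of_norm_eq {ω : ℂ → ℂ} (hω : DifferentiableOn ℂ ω (Metric.ball 0 1))
    (hle : ∀ z ∈ Metric.ball (0 : ℂ) 1, ‖ω z‖ ≤ ‖z‖) {z₀ : ℂ} (hz₀ : z₀ ∈ Metric.ball (0 : ℂ) 1)
    (h0 : z₀ ≠ 0) (heq : ‖ω z₀‖ = ‖z₀‖) :
    ∃ ε : ℂ, ‖ε‖ = 1 ∧ ∀ z ∈ Metric.ball (0 : ℂ) 1, ω z = ε * z := by
  have hω0 : ω 0 = 0 := by
    have := hle 0 (Metric.mem_ball_self one_pos)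
    simpa using this
  have hmaps : MapsTo ω (Metric.ball 0 1) (Metric.closedBall (ω 0) 1) := by
    intro z hz
    rw [hω0, mem_closedBall_zero_iff]
    exact (hle z hz).trans (mem_ball_zero_iff.1 hz).le
  obtain ⟨ε, hε, hE⟩ := Complex.affine_of_mapsTo_ball_of_exists_norm_dslope_eq_div' hω hmaps
    ⟨z₀, hz₀, by
      rw [dslope_of_ne _ h0, slope_def_field, hω0, sub_zero, sub_zero, norm_div, heq,
        div_self (norm_ne_zero_iff.2 h0), div_one]⟩
  refine ⟨ε, by simpa using hε, fun z hz => ?_⟩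
  have := hE hz
  simpa [hω0, mul_comm] using this

namespace IsStarlikeUnivalent
variable {h : ℂ → ℂ}

theorem ne_zero (hh : IsStarlikeUnivalent h) {z : ℂ} (hz : z ∈ Metric.ball (0 : ℂ) 1)
    (h0 : z ≠ 0) : h z ≠ 0 := fun hz0 =>
  h0 (hh.injOn hz (Metric.mem_ball_self one_pos) (hz0.trans hh.map_zero.symm))

/-- By starlikeness `t h` is subordinate to `h`, so `w = ψ z` for a Schwarz function ψ. -/
theorem norm_le_of_eq_mul (hh : IsStarlikeUnivalent h) {z w : ℂ} (hz : z ∈ Metric.ball (0 : ℂ) 1)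
    (hw : w ∈ Metric.ball (0 : ℂ) 1) {t : ℝ} (ht : t ∈ Icc (0 : ℝ) 1) (heq : h w = t * h z) :
    ‖w‖ ≤ ‖z‖ ∧ (‖w‖ = ‖z‖ → w = z) := by
  obtain ⟨ψ, hψ, hψ0, hψm⟩ := exists_schwarz_of_mapsTo hh.differentiableOn hh.injOn hh.map_zero
    (p := fun z => t * h z) (hh.differentiableOn.const_mul _) (by simp [hh.map_zero])
    fun z hz => hh.star z hz t ht
  have hwz : ψ z = w := hh.injOn (hψm z hz).1 hw ((hψm z hz).2.2.trans heq.symm)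
  refine ⟨hwz ▸ (hψm z hz).2.1, fun hn => ?_⟩
  rcases eq_or_ne z 0 with rfl | hz0
  · simpa using hn
  obtain ⟨ε, hε, hrot⟩ := exists_rotation_of_norm_eq hψ (fun z hz => (hψm z hz).2.1) hz hz0
    (hwz ▸ hn)
  have h00 := Metric.mem_ball_self (x := (0 : ℂ)) one_pos
  have hd := (hh.differentiableOn.differentiableAt (Metric.isOpen_ball.mem_nhds h00)).hasDerivAt
  have h1 : HasDerivAt (fun z => h (ε * z)) (deriv h 0 * ε) 0 := by
    have h2 : HasDerivAt (fun z : ℂ => ε * z) ε 0 := by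
      simpa using (hasDerivAt_id (0 : ℂ)).const_mul ε
    have h3 : HasDerivAt h (deriv h 0) (ε * 0) := by simpa using hd
    exact h3.comp 0 h2
  have h2 : HasDerivAt (fun z => h (ε * z)) (t * deriv h 0) 0 := by
    refine (hd.const_mul (t : ℂ)).congr_of_eventuallyEq ?_
    filter_upwards [Metric.isOpen_ball.mem_nhds h00] with x hx
    rw [← hrot x hx, (hψm x hx).2.2]
  have h3 := h1.unique h2
  rw [mul_comm] at h3
  -- If ψ is the rotation by ε, derivatives at 0 in `h (ε z) = t h(z)` give `ε = t`, and `|ε| = 1`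
  -- forces `t = 1`.
  have hεt : ε = t := mul_right_cancel₀
    (deriv_ne_zero_of_injOn Metric.isOpen_ball isPreconnected_unitBall hh.differentiableOn
      hh.injOn h00) h3
  have ht1 : t = 1 := by
    rw [hεt, Complex.norm_real, Real.norm_of_nonneg ht.1] at hε
    exact hε
  exact hh.injOn hw hz (by rw [heq, ht1]; simp)

theorem eq_of_norm_eq_of_eq_mul (hh : IsStarlikeUnivalent h) {z w : ℂ}
    (hz : z ∈ Metric.ball (0 : ℂ) 1) (hw : w ∈ Metric.ball (0 : ℂ) 1) {t : ℝ} (ht : 0 < t)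
    (heq : h w = t * h z) (hn : ‖w‖ = ‖z‖) : w = z := by
  rcases le_total t 1 with h1 | h1
  · exact (hh.norm_le_of_eq_mul hz hw ⟨ht.le, h1⟩ heq).2 hn
  · refine ((hh.norm_le_of_eq_mul (t := t⁻¹) hw hz ⟨by positivity, inv_le_one_of_one_le₀ h1⟩
      ?_).2 hn.symm).symm
    rw [heq]
    have : (t : ℂ) ≠ 0 := by exact_mod_cast ht.ne'
    push_cast
    field_simp

end IsStarlikeUnivalent

/-- `K` is the Alexander transform of the starlike function `h`: `z K'(z) = h(z)` and `K 0 = 0`. -/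
structure IsAlexanderTransform (K h : ℂ → ℂ) : Prop where
  differentiableOn : DifferentiableOn ℂ K (Metric.ball 0 1)
  map_zero : K 0 = 0
  mul_deriv : ∀ z ∈ Metric.ball (0 : ℂ) 1, z * deriv K z = h z
  deriv_ne_zero : ∀ z ∈ Metric.ball (0 : ℂ) 1, deriv K z ≠ 0

namespace IsAlexanderTransform
variable {K h : ℂ → ℂ}

theorem hasDerivAt (hK : IsAlexanderTransform K h) {z : ℂ} (hz : z ∈ Metric.ball (0 : ℂ) 1) :
    HasDerivAt K (deriv K z) z :=
  (hK.differentiableOn.differentiableAt (Metric.isOpen_ball.mem_nhds hz)).hasDerivAt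

theorem hasFDerivAt_re_mul (hK : IsAlexanderTransform K h) (c : ℂ) {z : ℂ}
    (hz : z ∈ Metric.ball (0 : ℂ) 1) :
    ∃ L' : ℂ →L[ℝ] ℝ, HasFDerivAt (fun z => (c * K z).re) L' z ∧
      ∀ v, L' v = (c * deriv K z * v).re := by
  have h1 := ((hK.hasDerivAt hz).const_mul c).hasFDerivAt.restrictScalars ℝ
  have h2 := Complex.reCLM.hasFDerivAt.comp z h1
  exact ⟨_, h2, fun v => by simp [mul_comm]⟩

/-- The boundary point `K z₀` is the unique maximiser over the closed disk of the linear functional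
in the direction `h z₀`. -/
theorem re_conj_mul_sub_neg (hK : IsAlexanderTransform K h) (hh : IsStarlikeUnivalent h)
    {z₀ z : ℂ} (hz₀ : z₀ ∈ Metric.ball (0 : ℂ) 1) (h0 : z₀ ≠ 0) (hz : ‖z‖ ≤ ‖z₀‖)
    (hne : z ≠ z₀) : ((starRingEnd ℂ) (h z₀) * (K z - K z₀)).re < 0 := by
  have hsub : Metric.closedBall (0 : ℂ) ‖z₀‖ ⊆ Metric.ball 0 1 :=
    Metric.closedBall_subset_ball (mem_ball_zero_iff.1 hz₀)
  set c := (starRingEnd ℂ) (h z₀) with hc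
  have hhz₀ := hh.ne_zero hz₀ h0
  have hc0 : c ≠ 0 := by rw [hc]; simpa using hhz₀
  have huniq : ∀ z₁ ∈ Metric.closedBall (0 : ℂ) ‖z₀‖,
      IsMaxOn (fun z => (c * K z).re) (Metric.closedBall 0 ‖z₀‖) z₁ → z₁ = z₀ := by
    intro z₁ hz₁ hmax
    obtain ⟨L', hL', hL'v⟩ := hK.hasFDerivAt_re_mul c (hsub hz₁)
    have hz₁n : ‖z₁‖ = ‖z₀‖ := by
      rw [mem_closedBall_zero_iff] at hz₁
      refine hz₁.antisymm (not_lt.1 fun hlt => ?_)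
      have hloc : IsLocalMax (fun z => (c * K z).re) z₁ :=
        hmax.isLocalMax (mem_of_superset
          (Metric.isOpen_ball.mem_nhds (mem_ball_zero_iff.2 hlt)) Metric.ball_subset_closedBall)
      have h1 := hloc.hasFDerivAt_eq_zero hL'
      have h2 := hL'v ((starRingEnd ℂ) (c * deriv K z₁))
      rw [h1, Complex.mul_conj] at h2
      have h3 : c * deriv K z₁ = 0 := by
        rw [← Complex.normSq_eq_zero]
        simpa using h2.symm
      exact (mul_ne_zero hc0 (hK.deriv_ne_zero z₁ (hsub (by simpa using hz₁)))) h3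
    -- Since `z₁ K'(z₁) = h(z₁)`, the first-order condition says that `h z₁` lies on the ray through
    -- `h z₀`. With equal moduli, starlikeness gives `z₁ = z₀`.
    obtain ⟨κ, hκ, hκe⟩ := mul_nonneg_of_isMaxOn_closedBall hL' hL'v (hz₁n ▸ hmax)
    have hz₁0 : z₁ ≠ 0 := by rw [← norm_pos_iff, hz₁n, norm_pos_iff]; exact h0
    rw [mul_assoc, mul_comm (deriv K z₁), hK.mul_deriv z₁ (hsub hz₁)] at hκe
    have hκ0 : κ ≠ 0 := by
      rintro rfl
      exact mul_ne_zero hc0 (hh.ne_zero (hsub hz₁) hz₁0) (by simpa using hκe)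
    have hn : 0 < ‖h z₀‖ := norm_pos_iff.2 hhz₀
    refine hh.eq_of_norm_eq_of_eq_mul hz₀ (hsub hz₁) (t := κ / ‖h z₀‖ ^ 2)
      (div_pos (lt_of_le_of_ne hκ hκ0.symm) (by positivity)) ?_ hz₁n
    have hn' : (‖h z₀‖ : ℂ) ≠ 0 := by exact_mod_cast hn.ne'
    push_cast
    rw [← hκe, ← Complex.mul_conj', ← hc]
    field_simp
  obtain ⟨z₁, hz₁, hmax⟩ := (isCompact_closedBall (0 : ℂ) ‖z₀‖).exists_isMaxOn
    (f := fun z => (c * K z).re) ⟨0, by simp⟩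
    (Complex.continuous_re.comp_continuousOn
      (continuousOn_const.mul (hK.differentiableOn.continuousOn.mono hsub)))
  have h1 := huniq z₁ hz₁ hmax
  subst h1
  rw [mul_sub, Complex.sub_re, sub_neg]
  refine (hmax (mem_closedBall_zero_iff.2 hz)).lt_of_ne fun heq => hne ?_
  exact huniq z (mem_closedBall_zero_iff.2 hz) fun y hy => (hmax hy).trans heq.ge

theorem injOn (hK : IsAlexanderTransform K h) (hh : IsStarlikeUnivalent h) :
    InjOn K (Metric.ball 0 1) := by
  have key : ∀ z ∈ Metric.ball (0 : ℂ) 1, ∀ w ∈ Metric.ball (0 : ℂ) 1, ‖z‖ ≤ ‖w‖ → K z = K w →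
      z = w := by
    intro z _ w hw hle heq
    by_contra hne
    have hw0 : w ≠ 0 := by
      rintro rfl
      exact hne (by simpa using hle)
    have := hK.re_conj_mul_sub_neg hh hw hw0 hle hne
    simp [heq] at this
  intro z hz w hw heq
  rcases le_total ‖z‖ ‖w‖ with h1 | h1
  · exact key z hz w hw h1 heq
  · exact (key w hw z hz h1 heq.symm).symm

/-- If a point `w₀` of the hull lies outside, let `s w₀` be the last point of the segment from 0 to
`w₀` in the image. By openness it is `K z₁` with |z₁| = r. The supporting half-plane there contains
the hull and has 0 strictly inside, so it cannot contain `w₀`. -/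
theorem convex_image_closedBall (hK : IsAlexanderTransform K h) (hh : IsStarlikeUnivalent h)
    {r : ℝ} (hr : r < 1) : Convex ℝ (K '' Metric.closedBall 0 r) := by
  have hsub : Metric.closedBall (0 : ℂ) r ⊆ Metric.ball 0 1 := Metric.closedBall_subset_ball hr
  rcases lt_or_ge r 0 with hr0 | hr0
  · rw [Metric.closedBall_eq_empty.2 hr0, image_empty]; exact convex_empty
  set A := K '' Metric.closedBall 0 r with hA
  have hAc : IsCompact A := (isCompact_closedBall 0 r).image_of_continuousOn
    (hK.differentiableOn.continuousOn.mono hsub)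
  have h0A : (0 : ℂ) ∈ A := ⟨0, by simpa using hr0, hK.map_zero⟩
  rw [← convexHull_eq_self]
  refine subset_antisymm (fun w₀ hw₀ => ?_) (subset_convexHull ℝ A)
  by_contra hw₀A
  have hTc : IsCompact (Icc (0 : ℝ) 1 ∩ (fun s : ℝ => (s : ℂ) * w₀) ⁻¹' A) :=
    isCompact_Icc.inter_right (hAc.isClosed.preimage (by fun_prop))
  obtain ⟨s, ⟨⟨hs0, hs1⟩, z₁, hz₁, hKz₁⟩, hsmax⟩ := hTc.exists_isMaxOn (f := id)
    ⟨0, by simp, by simpa using h0A⟩ continuousOn_id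
  have hKz₁' : K z₁ = s * w₀ := hKz₁
  have hs1' : s < 1 := by
    refine lt_of_le_of_ne hs1 ?_
    rintro rfl
    exact hw₀A ⟨z₁, hz₁, by simpa using hKz₁'⟩
  have hz₁n : ‖z₁‖ = r := by
    rw [mem_closedBall_zero_iff] at hz₁
    refine hz₁.antisymm (not_lt.1 fun hlt => ?_)
    have hopen : IsOpen (K '' Metric.ball 0 r) :=
      isOpen_image_of_injOn Metric.isOpen_ball isPreconnected_unitBall hK.differentiableOn
        (hK.injOn hh) (Metric.ball_subset_closedBall.trans hsub) Metric.isOpen_ball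
    have hcont : Continuous fun s : ℝ => (s : ℂ) * w₀ := by fun_prop
    have hmem : (fun s : ℝ => (s : ℂ) * w₀) ⁻¹' (K '' Metric.ball 0 r) ∈ 𝓝 s :=
      (hopen.preimage hcont).mem_nhds ⟨z₁, by simpa using hlt, hKz₁'⟩
    have hev : ∀ᶠ s' in 𝓝[>] s, s' ∈ (fun s : ℝ => (s : ℂ) * w₀) ⁻¹' (K '' Metric.ball 0 r) :=
      nhdsWithin_le_nhds hmem
    have hev' : ∀ᶠ s' in 𝓝[>] s, s' < 1 := nhdsWithin_le_nhds (eventually_lt_nhds hs1')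
    obtain ⟨s', hs', hs'1, hs's⟩ := (hev.and (hev'.and self_mem_nhdsWithin)).exists
    have hs's' : s < s' := hs's
    have := hsmax (show s' ∈ Icc (0 : ℝ) 1 ∩ (fun s : ℝ => (s : ℂ) * w₀) ⁻¹' A from
      ⟨⟨by linarith, le_of_lt hs'1⟩, image_mono Metric.ball_subset_closedBall hs'⟩)
    exact absurd this (not_le.2 hs's')
  have hz₁0 : z₁ ≠ 0 := by
    rintro rfl
    have hr' : r = 0 := by simpa using hz₁n.symm
    have hA0 : A = {0} := by rw [hA, hr']; simp [hK.map_zero]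
    rw [hA0] at hw₀ hw₀A
    simp at hw₀ hw₀A
    exact hw₀A hw₀
  set c := (starRingEnd ℂ) (h z₁) with hc
  have hhalf : ∀ a ∈ A, (c * (a - s * w₀)).re ≤ 0 := by
    rintro _ ⟨z, hz, rfl⟩
    rcases eq_or_ne z z₁ with rfl | hne
    · simp [hKz₁']
    · rw [← hKz₁']
      exact (hK.re_conj_mul_sub_neg hh (hsub hz₁) hz₁0
        (hz₁n ▸ mem_closedBall_zero_iff.1 hz) hne).le
  have hconv : Convex ℝ {a : ℂ | (c * (a - s * w₀)).re ≤ 0} := by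
    have e : {a : ℂ | (c * (a - s * w₀)).re ≤ 0} =
        {a : ℂ | (Complex.reCLM.comp (ContinuousLinearMap.mul ℝ ℂ c)) a ≤ (c * (s * w₀)).re} := by
      ext a
      simp [mul_sub]
    rw [e]
    exact convex_halfSpace_le (LinearMap.isLinear _) _
  have h1 := convexHull_min hhalf hconv hw₀
  have h2 := hK.re_conj_mul_sub_neg hh (hsub hz₁) hz₁0 (z := 0) (by simp) hz₁0.symm
  rw [hK.map_zero, hKz₁', zero_sub, ← hc] at h2
  have h3 : (c * (w₀ - s * w₀)).re = (1 - s) * (c * w₀).re := by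
    rw [← Complex.re_ofReal_mul]; congr 1; push_cast; ring
  have h4 : (c * -(s * w₀)).re = -(s * (c * w₀).re) := by
    rw [← Complex.re_ofReal_mul, ← Complex.neg_re]; congr 1; ring
  have h1' : (1 - s) * (c * w₀).re ≤ 0 := h3 ▸ h1
  rw [h4] at h2
  have h5 : 0 < (c * w₀).re := by
    by_contra hcon
    have := mul_nonneg_of_nonpos_of_nonpos (neg_nonpos.2 hs0) (not_lt.1 hcon)
    linarith
  nlinarith

theorem convex_image (hK : IsAlexanderTransform K h) (hh : IsStarlikeUnivalent h) :
    Convex ℝ (K '' Metric.ball 0 1) := by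
  rintro _ ⟨z, hz, rfl⟩ _ ⟨w, hw, rfl⟩ a b ha hb hab
  have hr : max ‖z‖ ‖w‖ < 1 := max_lt (mem_ball_zero_iff.1 hz) (mem_ball_zero_iff.1 hw)
  have := hK.convex_image_closedBall hh hr ⟨z, by simp, rfl⟩ ⟨w, by simp, rfl⟩ ha hb hab
  exact image_mono (Metric.closedBall_subset_ball hr) this

end IsAlexanderTransform

/-! ### From the differential condition to subordination. -/

/-- At a maximum of `‖ω z / z‖` over a closed disk, `z ω'(z) = k ω(z)` with `k ≥ 1`. -/
theorem deriv_eq_mul_of_isMaxOn_dslope {ω : ℂ → ℂ} {R : ℝ}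
    (hω : DifferentiableOn ℂ ω (Metric.ball 0 R)) (hω0 : ω 0 = 0) {z₀ : ℂ}
    (hz₀ : z₀ ∈ Metric.ball (0 : ℂ) R) (hne : dslope ω 0 z₀ ≠ 0)
    (hmax : IsMaxOn (fun z => ‖dslope ω 0 z‖) (Metric.closedBall 0 ‖z₀‖) z₀) :
    ∃ k : ℝ, 1 ≤ k ∧ z₀ * deriv ω z₀ = k * ω z₀ := by
  have hR : 0 < R := Metric.pos_of_mem_ball hz₀
  have hQd : DifferentiableOn ℂ (dslope ω 0) (Metric.ball 0 R) :=
    (Complex.differentiableOn_dslope (Metric.isOpen_ball.mem_nhds (Metric.mem_ball_self hR))).2 hω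
  set Q := dslope ω 0 with hQ
  have hωQ : ∀ z, ω z = z * Q z := fun z => by
    have := sub_smul_dslope ω 0 z
    rw [hω0, sub_zero, sub_zero, smul_eq_mul] at this
    exact this.symm
  have hQz := (hQd.differentiableAt (Metric.isOpen_ball.mem_nhds hz₀)).hasDerivAt
  have hωz : deriv ω z₀ = Q z₀ + z₀ * deriv Q z₀ := by
    have h1 : HasDerivAt (fun z => z * Q z) (1 * Q z₀ + z₀ * deriv Q z₀) z₀ :=
      (hasDerivAt_id z₀).mul hQz
    rw [show ω = fun z => z * Q z from funext hωQ]
    rw [h1.deriv, one_mul]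
  set c := (starRingEnd ℂ) (Q z₀) with hcdef
  obtain ⟨L', hL, hL'⟩ : ∃ L' : ℂ →L[ℝ] ℝ, HasFDerivAt (fun z => (c * Q z).re) L' z₀ ∧
      ∀ v, L' v = (c * deriv Q z₀ * v).re := by
    have h1 := (hQz.const_mul c).hasFDerivAt.restrictScalars ℝ
    have h2 := Complex.reCLM.hasFDerivAt.comp z₀ h1
    exact ⟨_, h2, fun v => by simp [mul_comm]⟩
  -- A maximum of `|Q|` is also one of `re (conj (Q z₀) Q)`, to which the first-order condition
  -- applies.
  obtain ⟨κ, hκ, hκe⟩ := mul_nonneg_of_isMaxOn_closedBall hL (d := c * deriv Q z₀)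
    hL' (fun z hz => by
      have h1 : (c * Q z₀).re = ‖Q z₀‖ * ‖Q z₀‖ := by
        rw [mul_comm, hcdef, Complex.mul_conj, Complex.ofReal_re, Complex.normSq_eq_norm_sq, sq]
      have h2 : (c * Q z).re ≤ ‖Q z₀‖ * ‖Q z‖ := by
        refine (Complex.re_le_norm _).trans_eq ?_
        rw [norm_mul, hcdef, RCLike.norm_conj]
      change (c * Q z).re ≤ (c * Q z₀).re
      rw [h1]
      exact h2.trans (mul_le_mul_of_nonneg_left (hmax hz) (norm_nonneg _)))
  have hn : 0 < ‖Q z₀‖ := norm_pos_iff.2 hne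
  have hn' : (‖Q z₀‖ : ℂ) ≠ 0 := by exact_mod_cast hn.ne'
  refine ⟨1 + κ / ‖Q z₀‖ ^ 2, le_add_of_nonneg_right (by positivity), ?_⟩
  rw [hωz, hωQ z₀]
  push_cast
  rw [← hκe, ← Complex.mul_conj', ← hcdef]
  have hc : c ≠ 0 := by rw [hcdef]; simpa using hne
  field_simp

namespace IsAlexanderTransform
variable {K h : ℂ → ℂ}

/-- Let ω = K⁻¹ ∘ g and let |ω(z)/z| be maximal at z₀ on a closed disk. If this maximum is nonzero,
z₀ ω'(z₀) = k ω(z₀) with k ≥ 1, so z₀ g'(z₀) = k h(ω(z₀)). This is also h(w₁) with |w₁| ≤ |z₀| by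
the Schwarz lemma, and starlikeness gives |ω(z₀)| ≤ |w₁|. -/
theorem norm_invFunOn_le (hK : IsAlexanderTransform K h) (hh : IsStarlikeUnivalent h) {g : ℂ → ℂ}
    (hg : DifferentiableOn ℂ g (Metric.ball 0 1)) (hg0 : g 0 = 0)
    (hgh : ∀ z ∈ Metric.ball (0 : ℂ) 1, z * deriv g z ∈ h '' Metric.ball 0 1) {R : ℝ} (hR : R ≤ 1)
    (hgK : ∀ z ∈ Metric.ball (0 : ℂ) R, g z ∈ K '' Metric.ball 0 1) :
    ∀ z ∈ Metric.ball (0 : ℂ) R, ‖Function.invFunOn K (Metric.ball 0 1) (g z)‖ ≤ ‖z‖ := by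
  intro z hz
  have hR0 : 0 < R := Metric.pos_of_mem_ball hz
  have hRs : Metric.ball (0 : ℂ) R ⊆ Metric.ball 0 1 := Metric.ball_subset_ball hR
  have hinj := hK.injOn hh
  have h00 : (0 : ℂ) ∈ Metric.ball (0 : ℂ) 1 := Metric.mem_ball_self one_pos
  set ω : ℂ → ℂ := fun z => Function.invFunOn K (Metric.ball 0 1) (g z) with hωdef
  have hω : DifferentiableOn ℂ ω (Metric.ball 0 R) :=
    (differentiableOn_invFunOn Metric.isOpen_ball isPreconnected_unitBall
      hK.differentiableOn hinj).comp (hg.mono hRs) hgK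
  have hω0 : ω 0 = 0 := by
    have := hinj.leftInvOn_invFunOn h00
    rw [hK.map_zero] at this
    rw [hωdef]; simp only; rw [hg0, this]
  have hωm : ∀ z ∈ Metric.ball (0 : ℂ) R, ω z ∈ Metric.ball (0 : ℂ) 1 ∧ K (ω z) = g z := fun z hz =>
    ⟨Function.invFunOn_mem (hgK z hz), Function.invFunOn_eq (hgK z hz)⟩
  rcases eq_or_ne z 0 with rfl | hz0
  · change ‖ω 0‖ ≤ _
    rw [hω0]
  set r := ‖z‖ with hr
  have hr0 : 0 < r := norm_pos_iff.2 hz0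
  have hrR : r < R := mem_ball_zero_iff.1 hz
  have hsub : Metric.closedBall (0 : ℂ) r ⊆ Metric.ball 0 R := Metric.closedBall_subset_ball hrR
  have hQd : DifferentiableOn ℂ (dslope ω 0) (Metric.ball 0 R) :=
    (Complex.differentiableOn_dslope (Metric.isOpen_ball.mem_nhds (Metric.mem_ball_self hR0))).2 hω
  obtain ⟨z₀, hz₀, hmax⟩ := Complex.exists_mem_frontier_isMaxOn_norm (F := ℂ) Metric.isBounded_ball
    (Metric.nonempty_ball.2 hr0) ((hQd.mono hsub).diffContOnCl_ball subset_rfl)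
  rw [frontier_ball _ hr0.ne', mem_sphere_zero_iff_norm] at hz₀
  rw [closure_ball _ hr0.ne'] at hmax
  have hz₀R : z₀ ∈ Metric.ball (0 : ℂ) R := hsub (by rw [mem_closedBall_zero_iff, hz₀])
  have hz₀0 : z₀ ≠ 0 := by rw [← norm_pos_iff, hz₀]; exact hr0
  have hωQ : ∀ z, ω z = z * dslope ω 0 z := fun z => by
    have := sub_smul_dslope ω 0 z
    rw [hω0, sub_zero, sub_zero, smul_eq_mul] at this
    exact this.symm
  have hQ1 : ‖dslope ω 0 z₀‖ ≤ 1 := by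
    rcases eq_or_ne (dslope ω 0 z₀) 0 with h0 | hne
    · rw [h0]; simp
    obtain ⟨k, hk, hke⟩ := deriv_eq_mul_of_isMaxOn_dslope hω hω0 hz₀R hne (by rw [hz₀]; exact hmax)
    obtain ⟨w₁, hw₁, hw₁n, hw₁e⟩ : ∃ w₁ ∈ Metric.ball (0 : ℂ) 1, ‖w₁‖ ≤ ‖z₀‖ ∧
        h w₁ = z₀ * deriv g z₀ := by
      obtain ⟨ψ, -, -, hψ⟩ := exists_schwarz_of_mapsTo hh.differentiableOn hh.injOn hh.map_zero
        (p := fun z => z * deriv g z) (differentiableOn_id.mul (hg.deriv Metric.isOpen_ball))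
        (by simp) hgh
      exact ⟨ψ z₀, (hψ z₀ (hRs hz₀R)).1, (hψ z₀ (hRs hz₀R)).2⟩
    obtain ⟨hω1, hω2⟩ := hωm z₀ hz₀R
    have hdg : deriv g z₀ = deriv K (ω z₀) * deriv ω z₀ := by
      have h1 := (hK.hasDerivAt hω1).comp z₀
        (hω.differentiableAt (Metric.isOpen_ball.mem_nhds hz₀R)).hasDerivAt
      rw [← h1.deriv]
      refine Filter.EventuallyEq.deriv_eq ?_
      filter_upwards [Metric.isOpen_ball.mem_nhds hz₀R] with x hx using (hωm x hx).2.symm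
    have hkey : h w₁ = k * h (ω z₀) := by
      rw [hw₁e, hdg, mul_left_comm, hke, ← hK.mul_deriv _ hω1]
      ring
    have hk0 : (k : ℂ) ≠ 0 := by
      exact_mod_cast (by linarith : k ≠ 0)
    have h2 : ‖ω z₀‖ ≤ ‖w₁‖ := (hh.norm_le_of_eq_mul hw₁ hω1 (t := k⁻¹)
      ⟨by positivity, inv_le_one_of_one_le₀ hk⟩ (by
        rw [hkey]; push_cast; rw [inv_mul_cancel_left₀ hk0])).1
    have h3 := h2.trans hw₁n
    rw [hωQ z₀, norm_mul] at h3
    exact le_of_mul_le_mul_left (by linarith) (norm_pos_iff.2 hz₀0)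
  have h4 : ‖dslope ω 0 z‖ ≤ 1 :=
    (hmax (show z ∈ Metric.closedBall (0 : ℂ) r by rw [mem_closedBall_zero_iff])).trans hQ1
  change ‖ω z‖ ≤ r
  rw [hωQ z, norm_mul]
  exact mul_le_of_le_one_right hr0.le h4

/-- At a point z₀ of least modulus where `g` leaves the image, the bound on smaller disks keeps `g`
in the compact set K({|z| ≤ |z₀|}), which then also contains `g z₀`. -/
theorem mapsTo_image (hK : IsAlexanderTransform K h) (hh : IsStarlikeUnivalent h) {g : ℂ → ℂ}
    (hg : DifferentiableOn ℂ g (Metric.ball 0 1)) (hg0 : g 0 = 0)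
    (hgh : ∀ z ∈ Metric.ball (0 : ℂ) 1, z * deriv g z ∈ h '' Metric.ball 0 1) :
    ∀ z ∈ Metric.ball (0 : ℂ) 1, g z ∈ K '' Metric.ball 0 1 := by
  by_contra! hcon
  obtain ⟨z₁, hz₁, hz₁'⟩ := hcon
  have hopen : IsOpen (K '' Metric.ball 0 1) :=
    isOpen_image_of_injOn Metric.isOpen_ball isPreconnected_unitBall hK.differentiableOn
      (hK.injOn hh) subset_rfl Metric.isOpen_ball
  have hsub : Metric.closedBall (0 : ℂ) ‖z₁‖ ⊆ Metric.ball 0 1 :=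
    Metric.closedBall_subset_ball (mem_ball_zero_iff.1 hz₁)
  have hBc : IsCompact (Metric.closedBall (0 : ℂ) ‖z₁‖ ∩ g ⁻¹' (K '' Metric.ball 0 1)ᶜ) :=
    (isCompact_closedBall 0 ‖z₁‖).of_isClosed_subset
      ((hg.continuousOn.mono hsub).preimage_isClosed_of_isClosed Metric.isClosed_closedBall
        hopen.isClosed_compl) inter_subset_left
  obtain ⟨z₀, ⟨hz₀, hz₀'⟩, hmin⟩ := hBc.exists_isMinOn (f := fun z => ‖z‖)
    ⟨z₁, by simp, hz₁'⟩ continuous_norm.continuousOn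
  have hz₀1 := mem_ball_zero_iff.1 (hsub hz₀)
  have hz₀0 : z₀ ≠ 0 := by
    rintro rfl
    exact hz₀' ⟨0, Metric.mem_ball_self one_pos, by rw [hK.map_zero, hg0]⟩
  have hP : ∀ z ∈ Metric.ball (0 : ℂ) ‖z₀‖, g z ∈ K '' Metric.ball 0 1 := by
    intro z hz
    rw [mem_ball_zero_iff] at hz
    by_contra hz'
    refine absurd (hmin ⟨?_, hz'⟩) (not_le.2 hz)
    rw [mem_closedBall_zero_iff] at hz₀ ⊢
    exact hz.le.trans hz₀
  have hle := hK.norm_invFunOn_le hh hg hg0 hgh hz₀1.le hP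
  have hcl : IsClosed (K '' Metric.closedBall 0 ‖z₀‖) :=
    ((isCompact_closedBall 0 ‖z₀‖).image_of_continuousOn (hK.differentiableOn.continuousOn.mono
      (Metric.closedBall_subset_ball hz₀1))).isClosed
  have hball : ∀ z ∈ Metric.ball (0 : ℂ) ‖z₀‖, g z ∈ K '' Metric.closedBall 0 ‖z₀‖ := by
    intro z hz
    refine ⟨_, ?_, Function.invFunOn_eq (hP z hz)⟩
    rw [mem_closedBall_zero_iff]
    exact (hle z hz).trans (mem_ball_zero_iff.1 hz).le
  have hmem : g z₀ ∈ K '' Metric.closedBall 0 ‖z₀‖ := by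
    have hz₀cl : z₀ ∈ closure (Metric.ball (0 : ℂ) ‖z₀‖) := by
      rw [closure_ball _ (norm_ne_zero_iff.2 hz₀0)]; simp
    have := ((hg.continuousOn.continuousAt
      (Metric.isOpen_ball.mem_nhds (hsub hz₀))).continuousWithinAt
        (s := Metric.ball 0 ‖z₀‖)).mem_closure_image hz₀cl
    have hss : g '' Metric.ball 0 ‖z₀‖ ⊆ K '' Metric.closedBall 0 ‖z₀‖ := by
      rintro _ ⟨z, hz, rfl⟩
      exact hball z hz
    exact closure_minimal hss hcl this
  exact hz₀' (image_mono (Metric.closedBall_subset_ball hz₀1) hmem)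

end IsAlexanderTransform

/-! ### The functions log k' and log f', rotations, and harmonicity under `K`. -/

theorem zero_mem_unitDisk : (0 : ℂ) ∈ Metric.ball (0 : ℂ) 1 := Metric.mem_ball_self one_pos

theorem mul_mem_unitDisk {ε z : ℂ} (hε : ‖ε‖ = 1) (hz : z ∈ Metric.ball (0 : ℂ) 1) :
    ε * z ∈ Metric.ball (0 : ℂ) 1 := by
  rw [mem_ball_zero_iff] at hz ⊢
  rwa [norm_mul, hε, one_mul]

/-- The integrand may be wrong at the origin, as for `(φ ζ - 1) / ζ`, whose value there is 0 by
convention; the segment passes through it only at s = 0. -/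
theorem segmentIntegral_eq {P G g : ℂ → ℂ} (hP : ∀ z ∈ Metric.ball (0 : ℂ) 1, HasDerivAt P (G z) z)
    (hG : ContinuousOn G (Metric.ball 0 1)) (hP0 : P 0 = 0)
    (hg : ∀ z ∈ Metric.ball (0 : ℂ) 1, z ≠ 0 → g z = G z) {z : ℂ}
    (hz : z ∈ Metric.ball (0 : ℂ) 1) : segmentIntegral g z = P z := by
  have hmem : ∀ s ∈ Icc (0 : ℝ) 1, (s : ℂ) * z ∈ Metric.ball (0 : ℂ) 1 := by
    intro s hs
    rw [mem_ball_zero_iff] at hz ⊢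
    rw [norm_mul, Complex.norm_real, Real.norm_of_nonneg hs.1]
    exact (mul_le_of_le_one_left (norm_nonneg z) hs.2).trans_lt hz
  have h1 : segmentIntegral g z = ∫ s in (0 : ℝ)..1, z * G ((s : ℂ) * z) := by
    refine intervalIntegral.integral_congr_ae (ae_of_all _ fun s hs => ?_)
    rw [uIoc_of_le zero_le_one] at hs
    rcases eq_or_ne z 0 with rfl | hz0
    · simp
    · rw [hg _ (hmem s ⟨hs.1.le, hs.2⟩) (mul_ne_zero (by exact_mod_cast hs.1.ne') hz0)]
  have h2 : ∀ s ∈ uIcc (0 : ℝ) 1, HasDerivAt (fun s : ℝ => P (s * z)) (z * G (s * z)) s := by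
    intro s hs
    rw [uIcc_of_le zero_le_one] at hs
    have h3 : HasDerivAt (fun s : ℝ => (s : ℂ) * z) z s := by
      simpa using (Complex.ofRealCLM.hasDerivAt (x := s)).mul_const z
    rw [mul_comm]
    exact (hP _ (hmem s hs)).comp s h3
  rw [h1, intervalIntegral.integral_eq_sub_of_hasDerivAt h2]
  · simp [hP0]
  · refine ContinuousOn.intervalIntegrable ?_
    rw [uIcc_of_le zero_le_one]
    exact continuousOn_const.mul (hG.comp (by fun_prop) hmem)

/-- Analytic logarithms on the disk are unique. -/
theorem eqOn_of_exp_eq {A B : ℂ → ℂ} (hA : DifferentiableOn ℂ A (Metric.ball 0 1))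
    (hB : DifferentiableOn ℂ B (Metric.ball 0 1)) (h0 : A 0 = B 0)
    (h : ∀ z ∈ Metric.ball (0 : ℂ) 1, Complex.exp (A z) = Complex.exp (B z)) :
    EqOn A B (Metric.ball 0 1) := by
  refine Metric.isOpen_ball.eqOn_of_deriv_eq isPreconnected_unitBall hA hB ?_ zero_mem_unitDisk h0
  intro z hz
  have hAz := (hA.differentiableAt (Metric.isOpen_ball.mem_nhds hz)).hasDerivAt.cexp
  have hBz := (hB.differentiableAt (Metric.isOpen_ball.mem_nhds hz)).hasDerivAt.cexp
  have h1 := hAz.unique (hBz.congr_of_eventuallyEq (by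
    filter_upwards [Metric.isOpen_ball.mem_nhds hz] with x hx using h x hx))
  rw [h z hz] at h1
  exact mul_left_cancel₀ (Complex.exp_ne_zero _) h1

theorem isStarlikeUnivalent_sub_one {Ω : Set ℂ} (hΩ : StarConvex ℝ (1 : ℂ) Ω) {φ : ℂ → ℂ}
    (hφ : IsNormalizedConformalMap φ Ω) : IsStarlikeUnivalent fun z => φ z - 1 := by
  refine ⟨hφ.analytic.sub_const 1, fun z hz w hw h => hφ.injOn hz hw (sub_left_injective h),
    by simp [hφ.map_zero], fun z hz t ht => ?_⟩
  have h1 : φ z ∈ Ω := hφ.image_eq ▸ ⟨z, hz, rfl⟩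
  have h2 := hΩ h1 (sub_nonneg.2 ht.2) ht.1 (by ring)
  rw [← hφ.image_eq] at h2
  obtain ⟨w, hw, hwe⟩ := h2
  refine ⟨w, hw, ?_⟩
  simp only [hwe, Complex.real_smul]
  push_cast
  ring

/-- K is the primitive of the difference quotient of φ - 1 at 0, the holomorphic extension of (φ(ζ)
- 1)/ζ. -/
theorem exists_isAlexanderTransform {Ω : Set ℂ} (hΩ : StarConvex ℝ (1 : ℂ) Ω) {φ : ℂ → ℂ}
    (hφ : IsNormalizedConformalMap φ Ω) :
    ∃ K : ℂ → ℂ, IsAlexanderTransform K (fun z => φ z - 1) ∧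
      ∀ z ∈ Metric.ball (0 : ℂ) 1, HasDerivAt (kFun φ) (Complex.exp (K z)) z := by
  have hh := isStarlikeUnivalent_sub_one hΩ hφ
  set h : ℂ → ℂ := fun z => φ z - 1 with hdef
  have hQ : DifferentiableOn ℂ (dslope h 0) (Metric.ball 0 1) :=
    (Complex.differentiableOn_dslope (Metric.isOpen_ball.mem_nhds zero_mem_unitDisk)).2
      hh.differentiableOn
  obtain ⟨K, hK0, hK⟩ := (Complex.IsExactOn.with_val_at hQ.isExactOn_ball 0 0)
  have hKd : DifferentiableOn ℂ K (Metric.ball 0 1) := fun z hz =>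
    (hK z hz).differentiableAt.differentiableWithinAt
  have hKA : IsAlexanderTransform K h := by
    refine ⟨hKd, hK0, fun z hz => ?_, fun z hz => ?_⟩
    · have := sub_smul_dslope h 0 z
      rw [(hK z hz).deriv]
      simpa [hh.map_zero] using this
    · rw [(hK z hz).deriv]
      rcases eq_or_ne z 0 with rfl | hz0
      · rw [dslope_same]
        exact deriv_ne_zero_of_injOn Metric.isOpen_ball isPreconnected_unitBall
          hh.differentiableOn hh.injOn zero_mem_unitDisk
      · rw [dslope_of_ne _ hz0, slope_def_field, hh.map_zero, sub_zero, sub_zero]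
        exact div_ne_zero (hh.ne_zero hz hz0) hz0
  refine ⟨K, hKA, ?_⟩
  have hseg : ∀ z ∈ Metric.ball (0 : ℂ) 1, segmentIntegral (fun ζ => (φ ζ - 1) / ζ) z = K z :=
    fun z hz => segmentIntegral_eq hK hQ.continuousOn hK0 (fun w _ hw0 => by
      rw [dslope_of_ne _ hw0, slope_def_field, hh.map_zero, sub_zero, sub_zero]) hz
  have hexp : DifferentiableOn ℂ (fun z => Complex.exp (K z)) (Metric.ball 0 1) := hKd.cexp
  obtain ⟨k, hk0, hk⟩ := (Complex.IsExactOn.with_val_at hexp.isExactOn_ball 0 0)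
  intro z hz
  refine (hk z hz).congr_of_eventuallyEq ?_
  filter_upwards [Metric.isOpen_ball.mem_nhds hz] with x hx
  exact segmentIntegral_eq hk hexp.continuousOn hk0 (fun w hw _ => by rw [hseg w hw]) hx

/-- Take the primitive g of f''/f' with g(0) = 0; then f' e^{-g} has zero derivative. -/
theorem exists_isLogDerivBranch {Ω : Set ℂ} {f : ℂ → ℂ} (hf : f ∈ classC Ω) :
    ∃ g : ℂ → ℂ, IsLogDerivBranch f g ∧
      ∀ z ∈ Metric.ball (0 : ℂ) 1, 1 + z * deriv g z ∈ Ω := by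
  obtain ⟨hfd, hf0, hf1, hfz⟩ := hf
  have hd1 : DifferentiableOn ℂ (deriv f) (Metric.ball 0 1) := hfd.deriv Metric.isOpen_ball
  have hd2 : DifferentiableOn ℂ (deriv (deriv f)) (Metric.ball 0 1) := hd1.deriv Metric.isOpen_ball
  have hq : DifferentiableOn ℂ (fun z => deriv (deriv f) z / deriv f z) (Metric.ball 0 1) :=
    hd2.div hd1 fun z hz => (hfz z hz).1
  obtain ⟨g, hg0, hg⟩ := (Complex.IsExactOn.with_val_at hq.isExactOn_ball 0 0)
  have hgd : DifferentiableOn ℂ g (Metric.ball 0 1) := fun z hz =>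
    (hg z hz).differentiableAt.differentiableWithinAt
  refine ⟨g, ⟨hgd, hg0, ?_⟩, fun z hz => ?_⟩
  · have hconst : EqOn (fun z => deriv f z * Complex.exp (-g z)) (fun _ => 1)
        (Metric.ball 0 1) := by
      refine Metric.isOpen_ball.eqOn_of_deriv_eq isPreconnected_unitBall (hd1.mul hgd.neg.cexp)
        (differentiableOn_const _) (fun z hz => ?_) zero_mem_unitDisk (by simp [hf1, hg0])
      have h1 := (hd1.differentiableAt (Metric.isOpen_ball.mem_nhds hz)).hasDerivAt.mul
        (hg z hz).neg.cexp
      have h2 : HasDerivAt (fun z => deriv f z * Complex.exp (-g z)) _ z := h1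
      rw [h2.deriv, deriv_const]
      have := (hfz z hz).1
      simp only [Pi.neg_apply]
      field_simp
      ring
    intro z hz
    have h1 : deriv f z * Complex.exp (-g z) = 1 := hconst hz
    rw [Complex.exp_neg] at h1
    exact (mul_inv_eq_one₀ (Complex.exp_ne_zero _)).1 h1 |>.symm
  · rw [(hg z hz).deriv, ← mul_div_assoc]
    exact (hfz z hz).2

theorem harmonicAt_re_of_differentiableAt {F : ℂ → ℂ} {S : Set ℂ} (hS : IsOpen S)
    (hF : DifferentiableOn ℂ F S) {z : ℂ} (hz : z ∈ S) :
    InnerProductSpace.HarmonicAt (fun z => (F z).re) z :=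
  (hF.analyticAt (hS.mem_nhds hz)).harmonicAt_re

theorem harmonicAt_comp {v : ℂ → ℝ} {K : ℂ → ℂ} {S : Set ℂ} (hS : IsOpen S)
    (hK : DifferentiableOn ℂ K S) {z : ℂ} (hz : z ∈ S)
    (hv : InnerProductSpace.HarmonicAt v (K z)) :
    InnerProductSpace.HarmonicAt (fun z => v (K z)) z := by
  obtain ⟨ε, hε, hball⟩ := Metric.isOpen_iff.1
    (InnerProductSpace.isOpen_setOfPred_harmonicAt v) (K z) hv
  obtain ⟨F, hF, hFe⟩ := InnerProductSpace.HarmonicOnNhd.exists_analyticOnNhd_ball_re_eq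
    (f := v) (z := K z) (R := ε) fun y hy => hball hy
  have hKz : AnalyticAt ℂ K z := hK.analyticAt (hS.mem_nhds hz)
  have h1 : AnalyticAt ℂ (fun z => F (K z)) z :=
    (hF (K z) (Metric.mem_ball_self hε)).comp hKz
  refine (InnerProductSpace.harmonicAt_congr_nhds ?_).1 h1.harmonicAt_re
  filter_upwards [hKz.continuousAt.preimage_mem_nhds (Metric.ball_mem_nhds _ hε)] with x hx
  exact hFe hx

theorem mul_conj_of_norm_eq_one {ε : ℂ} (hε : ‖ε‖ = 1) : (starRingEnd ℂ) ε * ε = 1 := by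
  rw [Complex.conj_mul', hε]; simp

theorem hasDerivAt_rotate {k k' : ℂ → ℂ}
    (hk : ∀ z ∈ Metric.ball (0 : ℂ) 1, HasDerivAt k (k' z) z) {ε : ℂ} (hε : ‖ε‖ = 1) {z : ℂ}
    (hz : z ∈ Metric.ball (0 : ℂ) 1) :
    HasDerivAt (fun z => (starRingEnd ℂ) ε * k (ε * z)) (k' (ε * z)) z := by
  have h1 : HasDerivAt (fun z : ℂ => ε * z) ε z := by
    simpa using (hasDerivAt_id z).const_mul ε
  have h2 := ((hk _ (mul_mem_unitDisk hε hz)).comp z h1).const_mul ((starRingEnd ℂ) ε)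
  rw [mul_left_comm, mul_conj_of_norm_eq_one hε, mul_one] at h2
  exact h2

theorem kFun_zero (φ : ℂ → ℂ) : kFun φ 0 = 0 := by
  simp [kFun, segmentIntegral]

/-- A function of the class is a rotation of `kFun φ` exactly when `log f'` is a rotation of
`log k'`. -/
theorem eq_rotate_kFun_iff {φ K f g : ℂ → ℂ} (hKd : DifferentiableOn ℂ K (Metric.ball 0 1))
    (hK0 : K 0 = 0)
    (hk : ∀ z ∈ Metric.ball (0 : ℂ) 1, HasDerivAt (kFun φ) (Complex.exp (K z)) z)
    (hfd : DifferentiableOn ℂ f (Metric.ball 0 1)) (hf0 : f 0 = 0) (hg : IsLogDerivBranch f g)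
    {ε : ℂ} (hε : ‖ε‖ = 1) :
    (∀ z ∈ Metric.ball (0 : ℂ) 1, f z = (starRingEnd ℂ) ε * kFun φ (ε * z)) ↔
      ∀ z ∈ Metric.ball (0 : ℂ) 1, g z = K (ε * z) := by
  constructor
  · intro h
    refine eqOn_of_exp_eq (B := fun z => K (ε * z)) hg.analytic
      (hKd.comp (by fun_prop) fun z hz => mul_mem_unitDisk hε hz)
      (by simp [hg.map_zero, hK0]) fun z hz => ?_
    rw [hg.exp_eq z hz]
    refine ((hasDerivAt_rotate hk hε hz).congr_of_eventuallyEq ?_).deriv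
    filter_upwards [Metric.isOpen_ball.mem_nhds hz] with x hx using h x hx
  · intro h
    refine Metric.isOpen_ball.eqOn_of_deriv_eq
      (g := fun z => (starRingEnd ℂ) ε * kFun φ (ε * z)) isPreconnected_unitBall hfd
      (fun z hz => (hasDerivAt_rotate hk hε hz).differentiableAt.differentiableWithinAt)
      (fun z hz => ?_) zero_mem_unitDisk (by simp [hf0, kFun_zero])
    rw [(hasDerivAt_rotate hk hε hz).deriv, ← hg.exp_eq z hz, h z hz]

/-- Harmonicity pulls back under `K`, and on a disk a harmonic function is globally the real part of
a holomorphic one. -/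
theorem isHarmonicOn_image_iff {u : ℂ → EReal} {K : ℂ → ℂ}
    (hK : DifferentiableOn ℂ K (Metric.ball 0 1)) (hinj : InjOn K (Metric.ball 0 1)) {r : ℝ}
    (hr : r ≤ 1) :
    IsHarmonicOn u (K '' Metric.ball 0 r) ↔
      ∃ F : ℂ → ℂ, DifferentiableOn ℂ F (Metric.ball 0 r) ∧
        ∀ z ∈ Metric.ball (0 : ℂ) r, u (K z) = (F z).re := by
  have hsub : Metric.ball (0 : ℂ) r ⊆ Metric.ball 0 1 := Metric.ball_subset_ball hr
  constructor
  · rintro ⟨v, hv, huv⟩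
    have hh : InnerProductSpace.HarmonicOnNhd (fun z => v (K z)) (Metric.ball 0 r) := fun z hz =>
      harmonicAt_comp Metric.isOpen_ball hK (hsub hz) (hv _ ⟨z, hz, rfl⟩)
    obtain ⟨F, hF, hFe⟩ := hh.exists_analyticOnNhd_ball_re_eq
    refine ⟨F, hF.differentiableOn, fun z hz => ?_⟩
    have h1 : (F z).re = v (K z) := hFe hz
    rw [huv _ ⟨z, hz, rfl⟩, h1]
  · rintro ⟨F, hF, hFe⟩
    have hl := hinj.leftInvOn_invFunOn
    have hL := differentiableOn_invFunOn Metric.isOpen_ball isPreconnected_unitBall hK hinj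
    have hopen := isOpen_image_of_injOn Metric.isOpen_ball isPreconnected_unitBall hK hinj hsub
      Metric.isOpen_ball
    have hFL : DifferentiableOn ℂ (fun w => F (Function.invFunOn K (Metric.ball 0 1) w))
        (K '' Metric.ball 0 r) := by
      refine hF.comp (hL.mono (image_mono hsub)) ?_
      rintro _ ⟨z, hz, rfl⟩
      rwa [hl (hsub hz)]
    refine ⟨fun w => (F (Function.invFunOn K (Metric.ball 0 1) w)).re,
      fun w hw => harmonicAt_re_of_differentiableAt hopen hFL hw, ?_⟩
    rintro _ ⟨z, hz, rfl⟩
    simp only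
    rw [hl (hsub hz), hFe z hz]

/-! ### The equality dichotomy and the main theorem. -/

/-- Integral means of a subharmonic function under a Schwarz function, with the equality case. -/
theorem angleIntegral_comp_schwarz {U : ℂ → EReal} (hU : IsSubharmonicOn U (Metric.ball 0 1))
    {ω : ℂ → ℂ} (hω : DifferentiableOn ℂ ω (Metric.ball 0 1))
    (hle : ∀ z ∈ Metric.ball (0 : ℂ) 1, ‖ω z‖ ≤ ‖z‖) {r : ℝ} (hr : r ∈ Ioo (0 : ℝ) 1) :
    angleIntegral (fun θ => U (ω (circlePt 0 r θ))) ≤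
        angleIntegral (fun θ => U (circlePt 0 r θ)) ∧
      (angleIntegral (fun θ => U (ω (circlePt 0 r θ))) =
          angleIntegral (fun θ => U (circlePt 0 r θ)) ↔
        (∃ F : ℂ → ℂ, DifferentiableOn ℂ F (Metric.ball 0 r) ∧
          ∀ z ∈ Metric.ball (0 : ℂ) r, U z = (F z).re) ∨
        ∃ ε : ℂ, ‖ε‖ = 1 ∧ ∀ z ∈ Metric.ball (0 : ℂ) 1, ω z = ε * z) := by
  have hrsub : Metric.closedBall (0 : ℂ) r ⊆ Metric.ball 0 1 := Metric.closedBall_subset_ball hr.2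
  have hωr : DiffContOnCl ℂ ω (Metric.ball 0 r) := (hω.mono hrsub).diffContOnCl_ball subset_rfl
  have hω0 : ω 0 = 0 := by
    have := hle 0 zero_mem_unitDisk
    simpa using this
  refine ⟨hU.angleIntegral_comp_le Metric.isOpen_ball hr.1 hrsub hωr hω0 fun z hz => ?_, ?_⟩
  · rw [mem_sphere_zero_iff_norm] at hz
    rw [mem_closedBall_zero_iff, ← hz]
    exact hle z (hrsub (mem_closedBall_zero_iff.2 hz.le))
  by_cases hrot : ∃ z₀ ∈ Metric.ball (0 : ℂ) 1, z₀ ≠ 0 ∧ ‖ω z₀‖ = ‖z₀‖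
  · obtain ⟨z₀, hz₀, hz₀0, hz₀n⟩ := hrot
    obtain ⟨ε, hε, hεω⟩ := exists_rotation_of_norm_eq hω hle hz₀ hz₀0 hz₀n
    refine iff_of_true ?_ (Or.inr ⟨ε, hε, hεω⟩)
    rw [← angleIntegral_rotate U r hε]
    exact congrArg angleIntegral (funext fun θ => by
      rw [hεω _ (hrsub (Metric.sphere_subset_closedBall (circlePt_mem_sphere 0 hr.1.le θ)))])
  push Not at hrot
  have hmaps : ∀ z ∈ Metric.closedBall (0 : ℂ) r, ω z ∈ Metric.ball (0 : ℂ) r := by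
    intro z hz
    rcases eq_or_ne z 0 with rfl | hz0
    · rw [hω0]; exact Metric.mem_ball_self hr.1
    · rw [mem_ball_zero_iff]
      rw [mem_closedBall_zero_iff] at hz
      have hz1 := hrsub (mem_closedBall_zero_iff.2 hz)
      exact (lt_of_le_of_ne (hle z hz1) (hrot z hz1 hz0)).trans_le hz
  constructor
  · intro heq
    exact Or.inl (hU.eq_re_of_angleIntegral_comp_eq Metric.isOpen_ball isPreconnected_unitBall
      hr.1 hrsub hωr hω0 hmaps heq)
  · rintro (⟨F, hF, hFe⟩ | ⟨ε, hε, hεω⟩)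
    · obtain ⟨h1, h2⟩ := integral_re_comp_circlePt hr.1 hF hωr hω0 hmaps
      have h3 : angleIntegral (fun θ => U (ω (circlePt 0 r θ))) =
          ((2 * Real.pi * (F 0).re : ℝ) : EReal) := by
        rw [← h2, ← angleIntegral_coe h1]
        exact congrArg angleIntegral (funext fun θ => hFe _ (hmaps _
          (Metric.sphere_subset_closedBall (circlePt_mem_sphere 0 hr.1.le θ))))
      rw [h3]
      -- `U = re F` is known only inside, so the boundary mean is squeezed between the sub-mean
      -- inequality at 0 and the bound from interior harmonicity.
      refine le_antisymm ?_ (hU.angleIntegral_le_of_eq_re Metric.isOpen_ball hr.1 hrsub hF hFe)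
      rw [EReal.coe_mul, ← hFe 0 (Metric.mem_ball_self hr.1)]
      exact hU.submean 0 r hr.1 hrsub
    · rw [← angleIntegral_rotate U r hε]
      exact congrArg angleIntegral (funext fun θ => by
        rw [hεω _ (hrsub (Metric.sphere_subset_closedBall (circlePt_mem_sphere 0 hr.1.le θ)))])

end MaMinda

open MaMinda in
theorem theorem2 (Ω : Set ℂ) (hΩ_open : IsOpen Ω) (hΩ_one : (1 : ℂ) ∈ Ω)
    (hΩ_ne : Ω ≠ Set.univ) (hΩ_star : StarConvex ℝ (1 : ℂ) Ω)
    (φ : ℂ → ℂ) (hφ : IsNormalizedConformalMap φ Ω) :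
    ∃ K : ℂ → ℂ, IsLogDerivBranch (kFun φ) K ∧ IsConvexUnivalent K ∧
      ∀ f ∈ classC Ω, ∃ g : ℂ → ℂ, IsLogDerivBranch f g ∧ Subordinate g K ∧
        ∀ u : ℂ → EReal, IsSubharmonicOn u (K '' unitDisk) → ∀ r ∈ Set.Ioo (0 : ℝ) 1,
          (angleIntegral fun θ => u (g (circlePt 0 r θ))) ≤
              (angleIntegral fun θ => u (K (circlePt 0 r θ))) ∧
          ((angleIntegral fun θ => u (g (circlePt 0 r θ))) =
              (angleIntegral fun θ => u (K (circlePt 0 r θ))) ↔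
            IsHarmonicOn u (K '' Metric.ball 0 r) ∨
              ∃ ε : ℂ, ‖ε‖ = 1 ∧
                ∀ z ∈ unitDisk, f z = (starRingEnd ℂ) ε * kFun φ (ε * z)) := by
  have hh := isStarlikeUnivalent_sub_one hΩ_star hφ
  obtain ⟨K, hK, hk⟩ := exists_isAlexanderTransform hΩ_star hφ
  have hinj := hK.injOn hh
  refine ⟨K, ⟨hK.differentiableOn, hK.map_zero, fun z hz => (hk z hz).deriv.symm⟩,
    ⟨hK.differentiableOn, hinj, hK.convex_image hh⟩, fun f hf => ?_⟩
  obtain ⟨g, hg, hgΩ⟩ := exists_isLogDerivBranch hf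
  have hgh : ∀ z ∈ Metric.ball (0 : ℂ) 1,
      z * deriv g z ∈ (fun z => φ z - 1) '' Metric.ball 0 1 := by
    intro z hz
    have h1 := hgΩ z hz
    rw [← hφ.image_eq] at h1
    obtain ⟨w, hw, hwe⟩ := h1
    exact ⟨w, hw, by simp [hwe]⟩
  have hmaps := hK.mapsTo_image hh hg.analytic hg.map_zero hgh
  obtain ⟨ω, hω, -, hωm⟩ := exists_schwarz_of_mapsTo hK.differentiableOn hinj hK.map_zero
    hg.analytic hg.map_zero hmaps
  refine ⟨g, hg, ⟨hg.analytic, hK.differentiableOn, ω, hω,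
    fun z hz => ⟨(hωm z hz).2.1, (hωm z hz).2.2.symm⟩⟩, fun u hu r hr => ?_⟩
  have hU : IsSubharmonicOn (u ∘ K) (Metric.ball 0 1) :=
    hu.comp_injOn Metric.isOpen_ball isPreconnected_unitBall hK.differentiableOn hinj
  have hgω : (fun θ => u (g (circlePt 0 r θ))) = fun θ => (u ∘ K) (ω (circlePt 0 r θ)) := by
    funext θ
    have hmem : circlePt 0 r θ ∈ Metric.ball (0 : ℂ) 1 := Metric.closedBall_subset_ball hr.2
      (Metric.sphere_subset_closedBall (circlePt_mem_sphere 0 hr.1.le θ))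
    simp only [Function.comp_apply, (hωm _ hmem).2.2]
  obtain ⟨h1, h2⟩ := angleIntegral_comp_schwarz hU hω (fun z hz => (hωm z hz).2.1) hr
  rw [hgω]
  refine ⟨h1, h2.trans (or_congr
    (isHarmonicOn_image_iff hK.differentiableOn hinj hr.2.le).symm
    (exists_congr fun ε => and_congr_right fun hε => ?_))⟩
  refine Iff.trans ?_ (eq_rotate_kFun_iff hK.differentiableOn hK.map_zero hk hf.1 hf.2.1 hg hε).symm
  -- As `g = K ∘ ω` and `K` is injective, `ω z = ε z` is equivalent to `g z = K (ε z)`.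
  refine forall₂_congr fun z hz => ?_
  rw [← (hωm z hz).2.2]
  exact (hinj.eq_iff (hωm z hz).1 (mul_mem_unitDisk hε hz)).symm
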